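/- Let $k$ be an algebraically closed field of characteristic $0$ and let $X$ be a smooth projective (integral) surface over $k$. For a divisor $D$ on $X$ and a fat point scheme $Z=\sum_i m_ip_i$ ($p_i\in X$ distinct closed points, $m_i\ge 0$ integers), let $\mathcal L=|D|\otimes\mathcal I(Z)$ be the linear system of all effective divisors linearly equivalent to $D$ that have multiplicity at least $m_i$ at $p_i$ for all $i$. Its dimension is $\dim\mathcal L=\dim_k H^0(X,\mathcal O_X(D)\otimes\mathcal I(Z))-1$, its virtual dimension is $v(\mathcal L)=\dim|D|-\sum_i m_i(m_i+1)/2$, its expected dimension is $e(\mathcal L)=\max\{v(\mathcal L),-1\}$, and $\mathcal L$ is called special if $\dim\mathcal L>e(\mathcal L)$, non-special otherwise. For a point $p$ outside $Z$, let $\mathcal L\otimes\mathcal I(2p)=|D|\otimes\mathcal I(Z+2p)$. Theorem. Suppose that $\mathcal L$ is non-special and that $\mathcal L\otimes\mathcal I(2p)$ is special for a general point $p\in X$, i.e. for all closed points $p$ of some non-empty open subset of $X$. Then: (1) for a general point $p\in X$, the (non-empty) system $\mathcal L\otimes\mathcal I(2p)$ has a double fixed component through $p$: there is an integral curve $C\subset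 X$ with $p\in C$ such that $2C\le E$ for every divisor $E\in\mathcal L\otimes\mathcal I(2p)$; (2) the image of the rational map $X\dashrightarrow\mathbb P^n$, $n=\dim\mathcal L$, given by $\mathcal L$ (the closure of the image of its domain of definition) is a curve. -/

import Mathlib

open AlgebraicGeometry CategoryTheory TopologicalSpace

universe u

noncomputable section

namespace FatPointSystems

attribute [local instance] MvPolynomial.gradedAlgebra

/-! ### Projective space over a field -/

/-- The projective space `ℙⁿ` over `k`, i.e. `Proj k[T₀, …, Tₙ]`. -/
abbrev projSpace (k : Type u) [Field k] (n : ℕ) : Scheme.{u} :=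
  Proj (MvPolynomial.homogeneousSubmodule (Fin (n + 1)) k)

/-- The inclusion of the constants `k` into the degree zero part of `k[T₀, …, Tₙ]`. -/
def constants (k : Type u) [Field k] (n : ℕ) :
    k →+* MvPolynomial.homogeneousSubmodule (Fin (n + 1)) k 0 :=
  algebraMap k (MvPolynomial.homogeneousSubmodule (Fin (n + 1)) k 0)

theorem algebraMap_comp_constants (k : Type u) [Field k] (n : ℕ) :
    (algebraMap (MvPolynomial.homogeneousSubmodule (Fin (n + 1)) k 0)
      (MvPolynomial (Fin (n + 1)) k)).comp (constants k n) = MvPolynomial.C :=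
  rfl

theorem constants_bijective (k : Type u) [Field k] (n : ℕ) :
    Function.Bijective (constants k n) := by
  constructor
  · intro a b hab
    exact MvPolynomial.C_injective (Fin (n + 1)) k (congrArg Subtype.val hab)
  · rintro ⟨x, hx⟩
    rw [MvPolynomial.homogeneousSubmodule_zero] at hx
    obtain ⟨c, rfl⟩ := Submodule.mem_one.mp hx
    exact ⟨c, rfl⟩

/-- The structure morphism `ℙⁿ ⟶ Spec k`. -/
def projSpaceToSpec (k : Type u) [Field k] (n : ℕ) :
    projSpace k n ⟶ Spec (CommRingCat.of k) :=
  Proj.toSpecZero (MvPolynomial.homogeneousSubmodule (Fin (n + 1)) k) ≫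
    Spec.map (CommRingCat.ofHom (constants k n))

instance projSpaceToSpec_locallyOfFiniteType (k : Type u) [Field k] (n : ℕ) :
    LocallyOfFiniteType (projSpaceToSpec k n) := by
  have : Algebra.FiniteType (MvPolynomial.homogeneousSubmodule (Fin (n + 1)) k 0)
      (MvPolynomial (Fin (n + 1)) k) := by
    have h : (algebraMap (MvPolynomial.homogeneousSubmodule (Fin (n + 1)) k 0)
        (MvPolynomial (Fin (n + 1)) k)).FiniteType := by
      refine RingHom.FiniteType.of_comp_finiteType (f := constants k n) ?_
      rw [algebraMap_comp_constants]
      exact RingHom.finiteType_algebraMap.mpr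
        (inferInstance : Algebra.FiniteType k (MvPolynomial (Fin (n + 1)) k))
    exact RingHom.finiteType_algebraMap.mp h
  have : IsIso (CommRingCat.ofHom (constants k n)) :=
    (ConcreteCategory.isIso_iff_bijective _).mpr (constants_bijective k n)
  unfold projSpaceToSpec
  infer_instance

/-- A `k`-scheme is projective if it is a closed subscheme of some `ℙⁿ` over `k`. -/
def IsProjective (k : Type u) [Field k] (X : Scheme.{u}) [X.Over (Spec (CommRingCat.of k))] :
    Prop :=
  ∃ (n : ℕ) (i : X ⟶ projSpace k n), IsClosedImmersion i ∧
    i ≫ projSpaceToSpec k n = X ↘ Spec (CommRingCat.of k)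

/-! ### Divisors and linear systems with fat points -/

/-- The function field of an integral `k`-scheme as a `k`-algebra. -/
instance functionFieldAlgebra (k : Type u) [Field k] (X : Scheme.{u}) [IsIntegral X]
    [X.Over (Spec (CommRingCat.of k))] : Algebra k X.functionField :=
  RingHom.toAlgebra
    ((Scheme.ΓSpecIso (CommRingCat.of k)).inv ≫ (X ↘ Spec (CommRingCat.of k)).appTop ≫
      X.presheaf.germ ⊤ (genericPoint X) trivial).hom

theorem algebraMap_functionField_mem_stalk (k : Type u) [Field k] (X : Scheme.{u}) [IsIntegral X]
    [X.Over (Spec (CommRingCat.of k))] (c : k) (x : X) :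
    ∃ b : X.presheaf.stalk x,
      algebraMap (X.presheaf.stalk x) X.functionField b = algebraMap k X.functionField c := by
  have : Nonempty (⊤ : X.Opens) := ⟨⟨x, trivial⟩⟩
  exact ⟨X.presheaf.germ ⊤ x trivial ((X ↘ Spec (CommRingCat.of k)).appTop
      ((Scheme.ΓSpecIso (CommRingCat.of k)).inv c)),
    Scheme.algebraMap_germ_eq_germToFunctionField X (U := ⊤) (x := x) trivial _⟩

/-- A Cartier divisor on an integral scheme: a local equation in `K(X)ˣ` at every point, such
that near each point the local equations differ by units of the local rings. Only the classes of
the local equations modulo units of the local rings matter. -/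
structure CartierDivisor (X : Scheme.{u}) [IsIntegral X] where
  eqn : X → X.functionField
  eqn_ne_zero : ∀ x, eqn x ≠ 0
  isLocal : ∀ x, ∃ U : X.Opens, x ∈ U ∧ ∀ y ∈ U, ∃ a : (X.presheaf.stalk y)ˣ,
    eqn y = algebraMap (X.presheaf.stalk y) X.functionField a * eqn x

section

variable (k : Type u) [Field k] {X : Scheme.{u}} [IsIntegral X]
  [X.Over (Spec (CommRingCat.of k))]

/-- The rational functions `s` such that the divisor `E = div s + D` is effective with multiplicity
at least `m` at the point `x`: the local equation `s * D.eqn x` of `E` at `x` lies in the `m`-th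
power of the maximal ideal of the local ring `𝒪_{X,x}`. For `m = 0`, this says that `E` is effective
near `x`; if `x` is the generic point of a curve `C`, it says that `E` is effective near `x` and
contains `C` with multiplicity at least `m`. -/
def CartierDivisor.multGE (D : CartierDivisor X) (x : X) (m : ℕ) :
    Submodule k X.functionField where
  carrier := {s | ∃ b ∈ IsLocalRing.maximalIdeal (X.presheaf.stalk x) ^ m,
    algebraMap (X.presheaf.stalk x) X.functionField b = s * D.eqn x}
  zero_mem' := ⟨0, zero_mem _, by simp⟩
  add_mem' := by
    rintro s t ⟨b, hb, hs⟩ ⟨c, hc, ht⟩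
    exact ⟨b + c, add_mem hb hc, by rw [map_add, hs, ht, add_mul]⟩
  smul_mem' := by
    rintro c s ⟨b, hb, hs⟩
    obtain ⟨a, ha⟩ := algebraMap_functionField_mem_stalk k X c x
    exact ⟨a * b, Ideal.mul_mem_left _ _ hb, by
      rw [map_mul, ha, hs, Algebra.smul_def, mul_assoc]⟩

/-- The space of sections `H⁰(X, 𝒪_X(D) ⊗ 𝓘(Z))` for the scheme of fat points `Z = ∑ mᵢ pᵢ`; its
projectivization is the linear system `|D| ⊗ 𝓘(Z)` of the effective divisors `div s + D` that
have multiplicity at least `mᵢ` at `pᵢ` for all `i`. -/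
def sections (D : CartierDivisor X) (Z : X →₀ ℕ) : Submodule k X.functionField :=
  ⨅ x, D.multGE k x (Z x)

/-- The projective dimension of `|D| ⊗ 𝓘(Z)`; it is `-1` for the empty system. -/
def dimSystem (D : CartierDivisor X) (Z : X →₀ ℕ) : ℤ :=
  (Module.finrank k (sections k D Z) : ℤ) - 1

/-- The virtual dimension `dim |D| - ∑ mᵢ (mᵢ + 1) / 2` of `|D| ⊗ 𝓘(Z)` on a surface. -/
def virtualDim (D : CartierDivisor X) (Z : X →₀ ℕ) : ℤ :=
  dimSystem k D 0 - Z.sum fun _ m => ((m * (m + 1) / 2 : ℕ) : ℤ)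

/-- The expected dimension of `|D| ⊗ 𝓘(Z)`. -/
def expectedDim (D : CartierDivisor X) (Z : X →₀ ℕ) : ℤ :=
  max (virtualDim k D Z) (-1)

/-- A system is special if its dimension is larger than the expected one. -/
def IsSpecial (D : CartierDivisor X) (Z : X →₀ ℕ) : Prop :=
  expectedDim k D Z < dimSystem k D Z

/-- `P` holds for a general (closed) point of `X`. -/
def ForGeneralPoint (X : Scheme.{u}) (P : X → Prop) : Prop :=
  ∃ U : X.Opens, (U : Set X).Nonempty ∧ ∀ p ∈ U, IsClosed ({p} : Set X) → P p

/-- The system `|D| ⊗ 𝓘(Z)` (is non-empty and) has a double fixed component through `p`: there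
is an integral curve `C` (with generic point `z`) through `p` such that `2C ≤ E` for every divisor
`E` of the system. -/
def HasDoubleFixedComponentThrough (D : CartierDivisor X) (Z : X →₀ ℕ) (p : X) : Prop :=
  sections k D Z ≠ ⊥ ∧
    ∃ z : X, Order.coheight z = 1 ∧ z ⤳ p ∧ sections k D Z ≤ D.multGE k z 2

/-! ### The rational map of a linear system -/

/-- Evaluation of polynomials at a tuple of rational functions. -/
def evalFunctions {n : ℕ} (f : Fin (n + 1) → X.functionField) :
    MvPolynomial (Fin (n + 1)) k →+* Γ(Spec X.functionField, ⊤) :=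
  (Scheme.ΓSpecIso X.functionField).inv.hom.comp
    (MvPolynomial.aeval (R := k) f).toRingHom

theorem evalFunctions_irrelevant {n : ℕ} (f : Fin (n + 1) → X.functionField) (hf : f ≠ 0) :
    (HomogeneousIdeal.irrelevant
      (MvPolynomial.homogeneousSubmodule (Fin (n + 1)) k)).toIdeal.map (evalFunctions k f) = ⊤ := by
  obtain ⟨i, hi⟩ := Function.ne_iff.mp hf
  refine Ideal.eq_top_of_isUnit_mem _ (Ideal.mem_map_of_mem _ (x := MvPolynomial.X i) ?_) ?_
  · have hX := MvPolynomial.isHomogeneous_X k i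
    exact HomogeneousIdeal.mem_irrelevant_of_mem _ Nat.one_pos hX
  · have h : evalFunctions k f (MvPolynomial.X i) =
        (Scheme.ΓSpecIso X.functionField).inv.hom (f i) := by
      simp [evalFunctions]
    rw [h]
    exact (IsUnit.mk0 (f i) hi).map _

/-- The `K(X)`-valued point `[f₀ : … : fₙ]` of `ℙⁿ`. -/
def functionFieldPoint {n : ℕ} (f : Fin (n + 1) → X.functionField) (hf : f ≠ 0) :
    Spec X.functionField ⟶ projSpace k n :=
  Proj.fromOfGlobalSections _ (evalFunctions k f) (evalFunctions_irrelevant k f hf)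

theorem functionFieldPoint_comp {n : ℕ} (f : Fin (n + 1) → X.functionField) (hf : f ≠ 0) :
    functionFieldPoint k f hf ≫ projSpaceToSpec k n =
      X.fromSpecStalk (genericPoint X) ≫ (X ↘ Spec (CommRingCat.of k)) := by
  have h1 : ((evalFunctions k f).comp (algebraMap
      (MvPolynomial.homogeneousSubmodule (Fin (n + 1)) k 0) _)).comp (constants k n) =
      (Scheme.ΓSpecIso X.functionField).inv.hom.comp (algebraMap k X.functionField) := by
    rw [RingHom.comp_assoc, algebraMap_comp_constants]
    ext c
    simp [evalFunctions]
  have h2 : X.fromSpecStalk (genericPoint X) ≫ (X ↘ Spec (CommRingCat.of k)) =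
      Spec.map (CommRingCat.ofHom (algebraMap k X.functionField)) := by
    rw [← cancel_mono (Spec (CommRingCat.of k)).toSpecΓ, Category.assoc,
      Scheme.toSpecΓ_naturality, Scheme.fromSpecStalk_toSpecΓ_assoc, ← SpecMap_ΓSpecIso_hom,
      ← Spec.map_comp, ← Spec.map_comp]
    congr 1
    change _ = (Scheme.ΓSpecIso (CommRingCat.of k)).hom ≫
      ((Scheme.ΓSpecIso (CommRingCat.of k)).inv ≫ (X ↘ Spec (CommRingCat.of k)).appTop ≫
      X.presheaf.germ ⊤ (genericPoint X) trivial)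
    rw [Iso.hom_inv_id_assoc]
  rw [h2, functionFieldPoint, projSpaceToSpec, Proj.fromOfGlobalSections_toSpecZero_assoc,
    ← Spec.map_comp, ← CommRingCat.ofHom_comp, h1, CommRingCat.ofHom_comp, Spec.map_comp,
    CommRingCat.ofHom_hom, toSpecΓ_SpecMap_ΓSpecIso_inv_assoc]

/-- The rational map `[f₀ : … : fₙ] : X ⤏ ℙⁿ`. -/
def rationalMap {n : ℕ} (f : Fin (n + 1) → X.functionField) (hf : f ≠ 0) :
    X ⤏ projSpace k n :=
  Scheme.RationalMap.ofFunctionField (X ↘ Spec (CommRingCat.of k)) (projSpaceToSpec k n)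
    (functionFieldPoint k f hf) (functionFieldPoint_comp k f hf)

theorem basis_ne_zero {n : ℕ} {V : Submodule k X.functionField}
    (b : Module.Basis (Fin (n + 1)) k V) : (fun i => (b i : X.functionField)) ≠ 0 :=
  fun h => b.ne_zero 0 (Subtype.ext (congrFun h 0))

/-- The image of a rational map: the closure of the image of its domain of definition. -/
def imageClosure {Y : Scheme.{u}} [Y.IsSeparated] (φ : X ⤏ Y) : Set Y :=
  closure (Set.range φ.toPartialMap.hom)

/-- The image of the rational map `X ⤏ ℙⁿ` given by `|D| ⊗ 𝓘(Z)`, i.e. by a basis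
`f₀, …, fₙ` of `H⁰(X, 𝒪_X(D) ⊗ 𝓘(Z))`, is a curve. (Another basis changes the map by a projective
transformation of `ℙⁿ`.) -/
def MapHasCurveAsImage (D : CartierDivisor X) (Z : X →₀ ℕ) : Prop :=
  ∃ (n : ℕ) (b : Module.Basis (Fin (n + 1)) k (sections k D Z)),
    topologicalKrullDim (imageClosure (rationalMap k (fun i => (b i : X.functionField))
      (basis_ne_zero k b))) = 1

end

end FatPointSystems
end

noncomputable section
namespace FatPointSystems

/-! ### Derivations and algebraic independence -/

section Derivations

open Polynomial

variable {k K : Type*} [Field k] [Field K] [Algebra k K]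

/-! Let V be the space of sections of the system and V(2p) the subspace with a further double point
at p. Comparing non-specialty with specialty shows that V(2p) is nonzero and that a general double
point imposes at most two conditions on V instead of three (`finrank_le_of_isSpecial`). Fix f₀ ≠ 0
in V. Since V(2p) ≠ 0, some ratio x = f₁/f₀ is nonconstant, hence transcendental over k. If another
ratio f₂/f₀ were algebraically independent of x, derivations dual to the pair would make the 1-jets
of f₀, f₁, f₂ at a general p independent, which is three conditions. So all ratios are algebraic
over k(x) (`isAlgebraic_adjoin_of_finrank_le`). The cone over the image then has dimension at most
two, and the image is a curve. For the fixed component, let t = x - x(p) at a general p. A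
derivation with δx = 1 shows t ∉ 𝔪², and Newton's method, applied to a separable equation of a ratio
over k[x], puts every ratio in k + kt + t²𝒪 (`forGeneralPoint_mem_firstOrder`). An element of this
form lying in 𝔪² is a multiple of t². Hence every member of the system with a double point at p
contains twice a component of t = 0 through p (`forGeneralPoint_exists_double_curve`). -/

open scoped IntermediateField.algebraAdjoinAdjoin in
theorem exists_derivation_of_isTranscendenceBasis [CharZero k] {ι : Type*} [DecidableEq ι]
    {v : ι → K} (hv : IsTranscendenceBasis k v) (i : ι) :
    ∃ δ : Derivation k K K, ∀ j, δ (v j) = if j = i then 1 else 0 := by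
  -- The polynomial ring maps to K by an isomorphism onto k[v], a localization to k(v), and an
  -- algebraic extension that is separable in characteristic 0. The composite is formally étale, so
  -- Ω of K is a base change and ∂/∂vᵢ extends to K.
  let : Algebra (MvPolynomial ι k) (Algebra.adjoin k (Set.range v)) :=
      hv.1.aevalEquiv.toAlgHom.toRingHom.toAlgebra
  let : Algebra (MvPolynomial ι k) K := (MvPolynomial.aeval v).toRingHom.toAlgebra
  have : IsScalarTower k (MvPolynomial ι k) K :=
    IsScalarTower.of_algebraMap_eq' (MvPolynomial.aeval v).comp_algebraMap.symm
  have : IsScalarTower (MvPolynomial ι k) (Algebra.adjoin k (Set.range v)) K := by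
    refine IsScalarTower.of_algebraMap_eq fun p => ?_
    exact (hv.1.algebraMap_aevalEquiv p).symm
  have h1 : Algebra.FormallyEtale (MvPolynomial ι k) (Algebra.adjoin k (Set.range v)) :=
    .of_equiv (AlgEquiv.ofBijective (Algebra.ofId (MvPolynomial ι k) (Algebra.adjoin k (Set.range
        v)))
      hv.1.aevalEquiv.bijective)
  have h2 : Algebra.FormallyEtale (Algebra.adjoin k (Set.range v)) (IntermediateField.adjoin k
      (Set.range v)) := .of_isLocalization (nonZeroDivisors _)
  have : Algebra.IsAlgebraic (IntermediateField.adjoin k (Set.range v)) K :=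
    hv.isAlgebraic_field
  have h3 : Algebra.FormallyEtale (IntermediateField.adjoin k (Set.range v)) K :=
      .of_isSeparable _ _
  have h4 : Algebra.FormallyEtale (Algebra.adjoin k (Set.range v)) K :=
      .comp _ (IntermediateField.adjoin k (Set.range v)) _
  have h5 : Algebra.FormallyEtale (MvPolynomial ι k) K := .comp _ (Algebra.adjoin k (Set.range v)) _
  let d : Derivation k (MvPolynomial ι k) K :=
    MvPolynomial.mkDerivation k (fun j => if j = i then 1 else 0)
  let l := (KaehlerDifferential.isBaseChange_of_formallyEtale k (MvPolynomial ι k) K).lift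
    d.liftKaehlerDifferential
  refine ⟨l.compDer (KaehlerDifferential.D k K), fun j => ?_⟩
  have h6 : v j = algebraMap (MvPolynomial ι k) K (MvPolynomial.X j) :=
    (MvPolynomial.aeval_X v j).symm
  have h7 := (KaehlerDifferential.isBaseChange_of_formallyEtale k (MvPolynomial ι k) K).lift_eq
    d.liftKaehlerDifferential (KaehlerDifferential.D k _ (MvPolynomial.X j))
  rw [KaehlerDifferential.map_D, ← h6, Derivation.liftKaehlerDifferential_comp_D] at h7
  refine h7.trans ?_
  exact MvPolynomial.mkDerivation_X _ _ _

theorem exists_derivation_of_algebraicIndependent [CharZero k] {ι : Type*} [DecidableEq ι]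
    {y : ι → K} (hy : AlgebraicIndependent k y) (i : ι) :
    ∃ δ : Derivation k K K, ∀ j, δ (y j) = if j = i then 1 else 0 := by
  classical
  obtain ⟨t, ht, hb⟩ :=
      exists_isTranscendenceBasis_superset (AlgebraicIndependent.to_subtype_range hy)
  obtain ⟨δ, hδ⟩ := exists_derivation_of_isTranscendenceBasis hb ⟨y i, ht ⟨i, rfl⟩⟩
  refine ⟨δ, fun j => ?_⟩
  have := hδ ⟨y j, ht ⟨j, rfl⟩⟩
  simpa [hy.injective.eq_iff] using this

/-- An element algebraic over `k(x)` satisfies a separable equation with coefficients in `k[x]`. -/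
theorem exists_bivariate_of_isAlgebraic [CharZero k] {x g : K} (hx : Transcendental k x)
    (hg : IsAlgebraic (Algebra.adjoin k {x}) g) :
    ∃ P : k[X][X], P.eval₂ (aeval x : k[X] →ₐ[k] K).toRingHom g = 0 ∧ (derivative P).eval₂ (aeval
        x : k[X] →ₐ[k] K).toRingHom g ≠ 0 := by
  have hex : ∃ n : ℕ, ∃ P : k[X][X], P ≠ 0 ∧ P.eval₂ (aeval x : k[X] →ₐ[k] K).toRingHom g = 0 ∧
      P.natDegree = n := by
    obtain ⟨p, hp0, hp⟩ := hg
    let φ : k[X] →+* Algebra.adjoin k {x} :=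
      ((aeval x : k[X] →ₐ[k] K).codRestrict (Algebra.adjoin k {x})
        (fun q => Polynomial.aeval_mem_adjoin_singleton k x)).toRingHom
    have hφ : Function.Surjective φ := by
      rintro ⟨b, hb⟩
      obtain ⟨q, rfl⟩ := (Algebra.adjoin_singleton_eq_range_aeval k x).le hb
      exact ⟨q, rfl⟩
    obtain ⟨P, rfl⟩ := Polynomial.map_surjective φ hφ p
    refine ⟨_, P, fun h => hp0 (by rw [h, Polynomial.map_zero]), ?_, rfl⟩
    rw [aeval_def, eval₂_map] at hp
    rw [← hp]
    rfl
  -- Take P of least degree in the outer variable. Transcendence of x excludes degree 0, so in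
  -- characteristic 0 the derivative is nonzero of smaller degree and cannot vanish at g.
  classical
  obtain ⟨P, hP0, hP, hdeg⟩ := Nat.find_spec hex
  have hmin := fun m => Nat.find_min hex (m := m)
  refine ⟨P, hP, fun h => ?_⟩
  have hd : P.natDegree ≠ 0 := by
    intro h0
    obtain ⟨q, rfl⟩ := natDegree_eq_zero.mp h0
    rw [eval₂_C] at hP
    exact hP0 (by rw [transcendental_iff.mp hx q hP, C_0])
  refine hmin _ ?_ ⟨derivative P, ?_, h, rfl⟩
  · rw [← hdeg]
    exact natDegree_derivative_lt hd
  · intro h0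
    exact hd (derivative_eq_zero.mp h0)

end Derivations


/-! ### Local rings with coefficient field `k` -/

section LocalAlgebra

open Polynomial IsLocalRing

variable {k R : Type*} [Field k] [CommRing R] [Algebra k R]

variable (k) in
/-- The elements of a `k`-algebra that are congruent to a linear polynomial in `t` modulo `t²`. -/
def firstOrder (t : R) : Subalgebra k R where
  carrier := {s | ∃ c₀ c₁ : k, ∃ v : R, s = algebraMap k R c₀ + algebraMap k R c₁ * t + t ^ 2 * v}
  mul_mem' := by
    rintro _ _ ⟨c₀, c₁, v, rfl⟩ ⟨d₀, d₁, w, rfl⟩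
    refine ⟨c₀ * d₀, c₀ * d₁ + c₁ * d₀, algebraMap k R c₁ * algebraMap k R d₁ +
      (algebraMap k R c₀ + algebraMap k R c₁ * t) * w +
      v * (algebraMap k R d₀ + algebraMap k R d₁ * t + t ^ 2 * w), ?_⟩
    simp only [map_add, map_mul]
    ring
  add_mem' := by
    rintro _ _ ⟨c₀, c₁, v, rfl⟩ ⟨d₀, d₁, w, rfl⟩
    refine ⟨c₀ + d₀, c₁ + d₁, v + w, ?_⟩
    simp only [map_add]
    ring
  algebraMap_mem' c := ⟨c, 0, 0, by simp⟩

theorem mem_firstOrder {t s : R} : s ∈ firstOrder k t ↔ ∃ c₀ c₁ : k, ∃ v : R,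
    s = algebraMap k R c₀ + algebraMap k R c₁ * t + t ^ 2 * v := Iff.rfl

theorem self_mem_firstOrder (t : R) : t ∈ firstOrder k t :=
  ⟨0, 1, 0, by simp⟩

theorem eval_mem_subalgebra (T : Subalgebra k R) {Q : R[X]} (hQ : ∀ n, Q.coeff n ∈ T) {b : R}
    (hb : b ∈ T) : Q.eval b ∈ T := by
  rw [eval_eq_sum_range]
  exact sum_mem fun n _ => mul_mem (hQ n) (pow_mem hb n)

variable [IsLocalRing R]

theorem eq_zero_of_algebraMap_mem_maximalIdeal {c : k}
    (hc : algebraMap k R c ∈ maximalIdeal R) : c = 0 := by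
  by_contra h
  exact (mem_maximalIdeal _).mp hc ((IsUnit.mk0 c h).map (algebraMap k R))

/-- A derivation that preserves a local ring maps the square of the maximal ideal into the
maximal ideal. -/
theorem derivation_mem_maximalIdeal {k R K : Type*} [Field k] [CommRing R] [IsLocalRing R]
    [Field K] [Algebra k K] [Algebra R K]
    {δ : Derivation k K K}
    (hδ : ∀ b : R, ∃ c : R, δ (algebraMap R K b) = algebraMap R K c) {b : R}
    (hb : b ∈ maximalIdeal R ^ 2) :
    ∃ c ∈ maximalIdeal R, δ (algebraMap R K b) = algebraMap R K c := by
  rw [pow_two] at hb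
  refine Submodule.mul_induction_on hb (fun x hx y hy => ?_) ?_
  · obtain ⟨x', hx'⟩ := hδ x
    obtain ⟨y', hy'⟩ := hδ y
    refine ⟨x * y' + y * x', add_mem (Ideal.mul_mem_right _ _ hx) (Ideal.mul_mem_right _ _ hy), ?_⟩
    rw [map_mul, Derivation.leibniz, hx', hy', smul_eq_mul, smul_eq_mul, map_add, map_mul, map_mul]
  · rintro x y ⟨x', hx, hx'⟩ ⟨y', hy, hy'⟩
    exact ⟨x' + y', add_mem hx hy, by rw [map_add, map_add, hx', hy', map_add]⟩

/-- Modulo t² the element is c₀ + c₁t. Lying in the maximal ideal kills c₀; lying in its square then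
kills c₁, because t is not in the square. -/
theorem exists_eq_sq_mul_of_mem_firstOrder {t u : R} (ht : t ∈ maximalIdeal R)
    (ht2 : t ∉ maximalIdeal R ^ 2) (hu : u ∈ firstOrder k t) (hu2 : u ∈ maximalIdeal R ^ 2) :
    ∃ v, u = t ^ 2 * v := by
  obtain ⟨c₀, c₁, v, rfl⟩ := hu
  have h1 : t ^ 2 * v ∈ maximalIdeal R ^ 2 := Ideal.mul_mem_right _ _ (Ideal.pow_mem_pow ht 2)
  have h2 := (Ideal.add_mem_iff_left _ h1).mp hu2
  have h0 : c₀ = 0 := by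
    refine eq_zero_of_algebraMap_mem_maximalIdeal (R := R) ?_
    exact (Ideal.add_mem_iff_left _ (Ideal.mul_mem_left _ _ ht)).mp
      (Ideal.pow_le_self two_ne_zero h2)
  subst h0
  rw [map_zero, zero_add] at h2
  have h1 : c₁ = 0 := by
    by_contra h
    exact ht2 ((Ideal.unit_mul_mem_iff_mem _ ((IsUnit.mk0 c₁ h).map (algebraMap k R))).mp h2)
  exact ⟨v, by simp [h1]⟩

/-- A simple root of a polynomial over `k + k t + t² R` lies in `k + k t + t² R`. -/
theorem root_mem_firstOrder (hk : ∀ b : R, ∃ c : k, b - algebraMap k R c ∈ maximalIdeal R)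
    {t : R} (ht : t ∈ maximalIdeal R) {Q : R[X]} (hQ : ∀ n, Q.coeff n ∈ firstOrder k t) {g : R}
    (hg : Q.eval g = 0) (hg' : IsUnit (Q.derivative.eval g)) : g ∈ firstOrder k t := by
  obtain ⟨b, hb⟩ := hk g
  obtain ⟨y, rfl⟩ : ∃ y, g = algebraMap k R b + y := ⟨_, (add_sub_cancel _ _).symm⟩
  rw [add_sub_cancel_left] at hb
  set β := algebraMap k R b with hβ
  -- One Newton step from the residue β of g: 0 = Q(β) + Q'(β)y + κy², where Q(β) = c₀ + c₁t + t²v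
  -- and Q'(β) = d₀ + d₁t + t²w.
  obtain ⟨κ, hκ⟩ := Q.binomExpansion β y
  obtain ⟨c₀, c₁, v, hc⟩ := mem_firstOrder.mp
    (eval_mem_subalgebra _ hQ ((firstOrder k t).algebraMap_mem b))
  obtain ⟨d₀, d₁, w, hd⟩ := mem_firstOrder.mp
    (eval_mem_subalgebra _ (Q := Q.derivative) (fun n => by
      rw [coeff_derivative]
      exact mul_mem (hQ _) (add_mem (natCast_mem _ n) (one_mem _)))
      ((firstOrder k t).algebraMap_mem b))
  rw [← hβ] at hc hd
  rw [hg] at hκ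
  have hunit : IsUnit (Q.derivative.eval β) := by
    by_contra h
    refine (mem_maximalIdeal _).mp ?_ hg'
    obtain ⟨r, hr⟩ := Q.derivative.sub_dvd_eval_sub (β + y) β
    rw [add_sub_cancel_left] at hr
    rw [sub_eq_iff_eq_add.mp hr]
    exact add_mem (Ideal.mul_mem_right _ _ hb) h
  have hd₀ : d₀ ≠ 0 := by
    rintro rfl
    refine (mem_maximalIdeal _).mp ?_ hunit
    rw [hd, map_zero, zero_add]
    exact add_mem (Ideal.mul_mem_left _ _ ht)
      (Ideal.mul_mem_right _ _ (Ideal.pow_mem_of_mem _ ht 2 two_pos))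
  have hc₀ : c₀ = 0 := by
    refine eq_zero_of_algebraMap_mem_maximalIdeal (R := R) ?_
    have : algebraMap k R c₀ = -(algebraMap k R c₁ * t + t ^ 2 * v +
        Q.derivative.eval β * y + κ * y ^ 2) := by
      linear_combination -hκ - hc
    rw [this]
    refine neg_mem (add_mem (add_mem (add_mem (Ideal.mul_mem_left _ _ ht) ?_)
      (Ideal.mul_mem_left _ _ hb)) (Ideal.mul_mem_left _ _ (Ideal.pow_mem_of_mem _ hb 2 two_pos)))
    exact Ideal.mul_mem_right _ _ (Ideal.pow_mem_of_mem _ ht 2 two_pos)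
  rw [hc₀, map_zero, zero_add] at hc
  have hunit' : IsUnit (Q.derivative.eval β + κ * y) := by
    by_contra h
    refine (mem_maximalIdeal _).mp ?_ hunit
    exact (Ideal.add_mem_iff_left _ (Ideal.mul_mem_left _ κ hb)).mp h
  obtain ⟨e, he⟩ := hunit'.exists_left_inv
  -- As c₀ = 0, t divides Q(β) = -y(Q'(β) + κy), and the second factor is a unit.
  obtain ⟨c, hyc⟩ : ∃ c, y = t * c :=
    ⟨-e * (algebraMap k R c₁ + t * v), by linear_combination -y * he - e * hκ - e * hc⟩
  have hD : algebraMap k R d₀⁻¹ * algebraMap k R d₀ = 1 := by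
    rw [← map_mul, inv_mul_cancel₀ hd₀, map_one]
  -- Since t divides y, the expansion modulo t² reads c₁t + d₀y = 0, which gives the linear
  -- coefficient.
  refine ⟨b, -(d₀⁻¹ * c₁), -algebraMap k R d₀⁻¹ * (v + algebraMap k R d₁ * c + t * w * c +
    κ * c ^ 2), ?_⟩
  rw [map_neg, map_mul, ← hβ]
  rw [hd, hc, hyc] at hκ
  rw [hyc]
  linear_combination -(t * c) * hD - algebraMap k R d₀⁻¹ * hκ

theorem eval₂_aeval_root_mem_firstOrder
    (hk : ∀ b : R, ∃ c : k, b - algebraMap k R c ∈ maximalIdeal R) {a : k} {x g : R}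
    (hx : x - algebraMap k R a ∈ maximalIdeal R) {P : k[X][X]}
    (hP : P.eval₂ (aeval x : k[X] →ₐ[k] R).toRingHom g = 0)
    (hP' : IsUnit (P.derivative.eval₂ (aeval x : k[X] →ₐ[k] R).toRingHom g)) :
    g ∈ firstOrder k (x - algebraMap k R a) := by
  refine root_mem_firstOrder hk hx (Q := P.map (aeval x : k[X] →ₐ[k] R).toRingHom) (fun n => ?_)
    (by rwa [Polynomial.eval_map]) (by rwa [derivative_map, Polynomial.eval_map])
  rw [coeff_map]
  have : x ∈ firstOrder k (x - algebraMap k R a) := by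
    have := add_mem (self_mem_firstOrder (k := k) (x - algebraMap k R a))
      ((firstOrder k (x - algebraMap k R a)).algebraMap_mem a)
    rwa [sub_add_cancel] at this
  exact Algebra.adjoin_le (Set.singleton_subset_iff.mpr this)
    (aeval_mem_adjoin_singleton k x)

/-- If the residue field is `k` then the ring of jets of order one is finite over `k`. -/
theorem finite_quotient_maximalIdeal_sq [IsNoetherianRing R]
    (hk : ∀ b : R, ∃ c : k, b - algebraMap k R c ∈ maximalIdeal R) :
    Module.Finite k (R ⧸ (maximalIdeal R ^ 2)) := by
  obtain ⟨S, hS⟩ := (isNoetherianRing_iff_ideal_fg R).mp inferInstance (maximalIdeal R)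
  let q := Ideal.Quotient.mkₐ k (maximalIdeal R ^ 2)
  -- Scalars from R act on 𝔪/𝔪² through their residues in k, so ideal generators of 𝔪 span over k.
  have key : ∀ r ∈ maximalIdeal R, q r ∈ Submodule.span k (q '' S) := by
    intro r hr
    rw [← hS] at hr
    refine Submodule.span_induction (p := fun r _ => q r ∈ Submodule.span k (q '' S))
      (fun r h => Submodule.subset_span ⟨r, h, rfl⟩) (by simp)
      (fun r s _ _ hr hs => by rw [map_add]; exact add_mem hr hs) (fun a r hr h => ?_) hr
    obtain ⟨c, hc⟩ := hk a
    have : q (a • r) = c • q r := by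
      rw [← map_smul, ← sub_eq_zero, ← map_sub, smul_eq_mul, Algebra.smul_def, ← sub_mul]
      refine Ideal.Quotient.eq_zero_iff_mem.mpr ?_
      rw [pow_two]
      exact Ideal.mul_mem_mul hc (hS ▸ hr)
    rw [this]
    exact Submodule.smul_mem _ _ h
  classical
  refine ⟨⟨insert 1 (S.image q), top_unique ?_⟩⟩
  rintro b -
  obtain ⟨b, rfl⟩ := Ideal.Quotient.mkₐ_surjective k _ b
  obtain ⟨c, hc⟩ := hk b
  have : q b = c • 1 + q (b - algebraMap k R c) := by
    rw [map_sub, AlgHom.commutes, Algebra.algebraMap_eq_smul_one, add_sub_cancel]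
  change q b ∈ _
  rw [this, Finset.coe_insert, Finset.coe_image]
  exact add_mem (Submodule.smul_mem _ _ (Submodule.subset_span (Set.mem_insert _ _)))
    (Submodule.span_mono (Set.subset_insert _ _) (key _ hc))

end LocalAlgebra


/-! ### The dimension of an affine cone -/

section Dimension

variable {k : Type*} [Field k]

theorem isAlgebraic_map_adjoin {E K : Type*} [Field E] [Field K] [Algebra k E] [Algebra k K]
    (φ : K →ₐ[k] E) {s : Set K} {g : K} (hg : IsAlgebraic (Algebra.adjoin k s) g) :
    IsAlgebraic (Algebra.adjoin k (φ '' s)) (φ g) := by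
  have h : ∀ a : Algebra.adjoin k s, φ a ∈ Algebra.adjoin k (φ '' s) := fun a => by
    rw [← AlgHom.map_adjoin]
    exact ⟨a, a.2, rfl⟩
  let ψ : Algebra.adjoin k s →ₐ[k] Algebra.adjoin k (φ '' s) :=
    (φ.comp (Algebra.adjoin k s).val).codRestrict _ h
  refine hg.ringHom_of_comp_eq ψ φ (fun a b hab => ?_) rfl
  exact Subtype.ext (φ.injective (congrArg Subtype.val hab))

/-- In the matroid of algebraic independence, an independent set inside the closure of s has at most
rank(s) elements. -/
theorem card_le_encard_of_algebraicIndependent {E : Type*} [Field E] [Algebra k E] {s : Set E}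
    {m : ℕ} {v : Fin m → E} (hv : AlgebraicIndependent k v)
    (hs : ∀ i, IsAlgebraic (Algebra.adjoin k s) (v i)) : (m : ℕ∞) ≤ s.encard := by
  have h1 : (AlgebraicIndependent.matroid k E).Indep (Set.range v) :=
    AlgebraicIndependent.matroid_indep_iff.mpr hv.to_subtype_range
  have h2 : Set.range v ⊆ (AlgebraicIndependent.matroid k E).closure s := by
    rintro _ ⟨i, rfl⟩
    rw [AlgebraicIndependent.matroid_closure_eq]
    exact hs i
  have h3 := h1.encard_le_eRk_of_subset h2
  rw [Matroid.eRk_closure_eq] at h3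
  have h4 : (Set.range v).encard = m := by
    rw [← Set.image_univ, hv.injective.encard_image, Set.encard_univ]
    simp
  exact h4 ▸ h3.trans (Matroid.eRk_le_encard _ _)

/-- By Noether normalization B is integral over a polynomial ring in m variables, so its dimension
is at most m by incomparability. The variables stay independent in E, which bounds m. -/
theorem ringKrullDim_le_encard {B E : Type*} [CommRing B] [IsDomain B] [Algebra k B]
    [Algebra.FiniteType k B] [Field E] [Algebra k E] (j : B →ₐ[k] E) (hj : Function.Injective j)
    {s : Set E} (hs : ∀ b, IsAlgebraic (Algebra.adjoin k s) (j b)) :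
    ringKrullDim B ≤ s.encard := by
  obtain ⟨m, g, hg, hint⟩ := exists_integral_inj_algHom_of_fg k B
  have h1 : ringKrullDim B ≤ ringKrullDim (MvPolynomial (Fin m) k) := by
    algebraize [g.toRingHom]
    have : Algebra.IsIntegral (MvPolynomial (Fin m) k) B := ⟨hint⟩
    refine Order.krullDim_le_of_strictMono
      (PrimeSpectrum.comap (algebraMap (MvPolynomial (Fin m) k) B)) fun p q hpq => ?_
    exact Ideal.IsIntegral.comap_lt_comap hpq
  have h2 : (m : ℕ∞) ≤ s.encard := by
    refine card_le_encard_of_algebraicIndependent (k := k) (v := fun i => j (g (.X i))) ?_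
      (fun i => hs _)
    have : MvPolynomial.aeval (fun i => j (g (.X i))) = j.comp g := by ext; simp
    rw [algebraicIndependent_iff_injective_aeval, this]
    exact hj.comp hg
  refine h1.trans ?_
  rw [MvPolynomial.ringKrullDim_of_isNoetherianRing, ringKrullDim_eq_zero_of_field, zero_add,
    Nat.card_fin]
  exact_mod_cast h2

variable (k) in
/-- The homomorphism `Tᵢ ↦ fᵢ X` whose kernel is the ideal of the cone over `[f₀ : … : fₙ]`. -/
def coneHom {K ι : Type*} [Field K] [Algebra k K] (f : ι → K) :
    MvPolynomial ι k →ₐ[k] Polynomial K :=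
  MvPolynomial.aeval fun i => Polynomial.C (f i) * Polynomial.X

/-- The variable X records the degree, so the kernel consists of the polynomials all of whose
homogeneous components vanish at f. -/
theorem coeff_coneHom {K ι : Type*} [Field K] [Algebra k K] (f : ι → K) (r : MvPolynomial ι k)
    (d : ℕ) : (coneHom k f r).coeff d =
      MvPolynomial.aeval f (MvPolynomial.homogeneousComponent d r) := by
  induction r using MvPolynomial.induction_on' with
  | add p q hp hq => rw [map_add, Polynomial.coeff_add, hp, hq, map_add, map_add]
  | monomial u a =>
    rw [MvPolynomial.homogeneousComponent_of_mem (MvPolynomial.isHomogeneous_monomial a rfl)]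
    have : coneHom k f (MvPolynomial.monomial u a) =
        Polynomial.C (MvPolynomial.aeval f (MvPolynomial.monomial u a)) *
          Polynomial.X ^ u.degree := by
      have h : (u.prod fun _ e => (Polynomial.X : Polynomial K) ^ e) = Polynomial.X ^ u.degree :=
        Finset.prod_pow_eq_pow_sum _ _ _
      rw [coneHom, MvPolynomial.aeval_monomial, MvPolynomial.aeval_monomial, map_mul,
        map_finsuppProd, mul_assoc, ← h, ← Finsupp.prod_mul]
      simp only [mul_pow, map_pow]
      rfl
    rw [this, Polynomial.coeff_C_mul_X_pow]
    split_ifs <;> simp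

/-- All fᵢX = (fᵢ/f₀)(f₀X), with f₀ standing for the entry at `i₀`, are algebraic over the field
generated by the two entries `i₀`, `i₁` times X. The transcendence degree is thus at most two. -/
theorem ringKrullDim_coneHom_range_le {K ι : Type*} [Finite ι] [Field K] [Algebra k K] {f : ι → K}
    {i₀ i₁ : ι} (h₀ : f i₀ ≠ 0)
    (halg : ∀ i, IsAlgebraic (Algebra.adjoin k {f i₁ / f i₀}) (f i / f i₀)) :
    ringKrullDim (coneHom k f).range ≤ 2 := by
  have : Algebra.FiniteType k (coneHom k f).range :=
    .of_surjective (coneHom k f).rangeRestrict (coneHom k f).rangeRestrict_surjective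
  let E := FractionRing (Polynomial K)
  let ψ : Polynomial K →ₐ[k] E := IsScalarTower.toAlgHom k (Polynomial K) E
  let φ : K →ₐ[k] E := ψ.comp (IsScalarTower.toAlgHom k K (Polynomial K))
  have hψ : Function.Injective ψ := IsFractionRing.injective (Polynomial K) E
  let X : E := ψ Polynomial.X
  have hX : X ≠ 0 := (map_ne_zero_iff ψ hψ).mpr Polynomial.X_ne_zero
  let s : Set E := {φ (f i₀) * X, φ (f i₁) * X}
  have hs : ∀ e ∈ s, IsAlgebraic (Algebra.adjoin k s) e := fun e he =>
    isAlgebraic_algebraMap (⟨e, Algebra.subset_adjoin he⟩ : Algebra.adjoin k s)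
  have h₀' : φ (f i₀) ≠ 0 := (map_ne_zero_iff φ φ.injective).mpr h₀
  have hquot : IsAlgebraic (Algebra.adjoin k s) (φ (f i₁ / f i₀)) := by
    have : φ (f i₁ / f i₀) = (φ (f i₁) * X) * (φ (f i₀) * X)⁻¹ := by
      rw [map_div₀, ← div_eq_mul_inv, mul_div_mul_right _ _ hX]
    rw [this]
    exact (hs _ (by simp [s])).mul (hs _ (by simp [s])).inv
  have hall : ∀ i, IsAlgebraic (Algebra.adjoin k s) (φ (f i) * X) := by
    intro i
    have : φ (f i) * X = φ (f i / f i₀) * (φ (f i₀) * X) := by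
      rw [map_div₀, ← mul_assoc, div_mul_cancel₀ _ h₀']
    rw [this]
    refine IsAlgebraic.mul ?_ (hs _ (by simp [s]))
    have h := isAlgebraic_map_adjoin φ (halg i)
    rw [Set.image_singleton] at h
    refine h.adjoin_of_forall_isAlgebraic ?_
    rintro x ⟨rfl, -⟩
    exact hquot
  have key : ∀ r, IsAlgebraic (Algebra.adjoin k s) (ψ (coneHom k f r)) := by
    intro r
    induction r using MvPolynomial.induction_on with
    | C a =>
      rw [← MvPolynomial.algebraMap_eq, AlgHom.commutes, AlgHom.commutes]
      exact isAlgebraic_algebraMap (algebraMap k (Algebra.adjoin k s) a)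
    | add p q hp hq => rw [map_add, map_add]; exact hp.add hq
    | mul_X p i hp =>
      rw [map_mul, map_mul]
      refine hp.mul ?_
      rw [coneHom, MvPolynomial.aeval_X, map_mul]
      exact hall i
  refine (ringKrullDim_le_encard (ψ.comp (coneHom k f).range.val)
    (hψ.comp Subtype.val_injective) (s := s) ?_).trans ?_
  · rintro ⟨_, r, rfl⟩
    exact key r
  · have h := Set.encard_insert_le {φ (f i₁) * X} (φ (f i₀) * X)
    rw [Set.encard_singleton, one_add_one_eq_two] at h
    exact WithBot.coe_le_coe.mpr h

end Dimension


/-! ### The closure of a point of projective space -/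

section ProjectiveImage

attribute [local instance] MvPolynomial.gradedAlgebra

variable (k : Type u) [Field k]

/-- The preimage of D₊(r) is the basic open set of φ(r), which in the spectrum of a field is
everything or empty. -/
theorem mem_fromOfGlobalSections_iff {n : ℕ} {F : Type u} [Field F]
    (φ : MvPolynomial (Fin (n + 1)) k →+* Γ(Spec (.of F), ⊤))
    (hφ : (HomogeneousIdeal.irrelevant
      (MvPolynomial.homogeneousSubmodule (Fin (n + 1)) k)).toIdeal.map φ = ⊤)
    (x : Spec (.of F)) {d : ℕ} (hd : 0 < d) {r : MvPolynomial (Fin (n + 1)) k}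
    (hr : r.IsHomogeneous d) :
    r ∈ (Proj.fromOfGlobalSections _ φ hφ x).asHomogeneousIdeal ↔ φ r = 0 := by
  have h := Proj.fromOfGlobalSections_preimage_basicOpen
    (MvPolynomial.homogeneousSubmodule (Fin (n + 1)) k) φ hφ hd hr
  have h1 : r ∉ (Proj.fromOfGlobalSections _ φ hφ x).asHomogeneousIdeal ↔
      x ∈ (Spec (.of F)).basicOpen (φ r) := by
    rw [← h]
    exact (Proj.mem_basicOpen _ _ _).symm
  rw [← not_iff_not, h1]
  constructor
  · intro hx h0
    rw [h0, Scheme.basicOpen_zero] at hx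
    exact hx
  · intro h0
    have : IsUnit (φ r) := by
      have h2 : (Scheme.ΓSpecIso (.of F)).hom (φ r) ≠ 0 := by
        intro h3
        refine h0 ?_
        have := congrArg (Scheme.ΓSpecIso (.of F)).inv h3
        simpa using this
      have h3 := (IsUnit.mk0 _ h2).map (Scheme.ΓSpecIso (.of F)).inv.hom
      simpa using h3
    rw [Scheme.basicOpen_of_isUnit _ this]
    trivial

/-- The point `[f₀ : … : fₙ]` of projective space for a tuple of elements of a field. -/
theorem exists_point_of_tuple {n : ℕ} {F : Type u} [Field F] [Algebra k F] (f : Fin (n + 1) → F)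
    (hf : f ≠ 0) : ∃ y : projSpace k n, ∀ d : ℕ, 0 < d → ∀ r : MvPolynomial (Fin (n + 1)) k,
      r.IsHomogeneous d → (r ∈ y.asHomogeneousIdeal ↔ MvPolynomial.aeval f r = 0) := by
  let φ : MvPolynomial (Fin (n + 1)) k →+* Γ(Spec (.of F), ⊤) :=
    (Scheme.ΓSpecIso (.of F)).inv.hom.comp (MvPolynomial.aeval (R := k) f).toRingHom
  have hφ : (HomogeneousIdeal.irrelevant
      (MvPolynomial.homogeneousSubmodule (Fin (n + 1)) k)).toIdeal.map φ = ⊤ := by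
    obtain ⟨i, hi⟩ := Function.ne_iff.mp hf
    refine Ideal.eq_top_of_isUnit_mem _ (Ideal.mem_map_of_mem _ (x := MvPolynomial.X i) ?_) ?_
    · exact HomogeneousIdeal.mem_irrelevant_of_mem _ Nat.one_pos (MvPolynomial.isHomogeneous_X k i)
    · have h : φ (MvPolynomial.X i) = (Scheme.ΓSpecIso (.of F)).inv.hom (f i) := by
        simp [φ]
      rw [h]
      exact (IsUnit.mk0 (f i) hi).map _
  have hinj : Function.Injective (Scheme.ΓSpecIso (.of F)).inv.hom :=
    (ConcreteCategory.bijective_of_isIso (Scheme.ΓSpecIso (.of F)).inv).1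
  refine ⟨Proj.fromOfGlobalSections _ φ hφ (IsLocalRing.closedPoint F), fun d hd r hr => ?_⟩
  exact (mem_fromOfGlobalSections_iff k φ hφ _ hd hr).trans (map_eq_zero_iff _ hinj)

variable {k}

theorem projSpace_specializes_iff {n : ℕ} {x y : projSpace k n} :
    x ⤳ y ↔ x.asHomogeneousIdeal ≤ y.asHomogeneousIdeal := by
  rw [specializes_iff_mem_closure]
  exact (ProjectiveSpectrum.le_iff_mem_closure (MvPolynomial.homogeneousSubmodule (Fin (n + 1)) k)
    x y).symm

/-- Degree 0 needs no test: a proper ideal contains no nonzero constant. -/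
theorem homogeneousIdeal_le_of_forall {n : ℕ} {I J : HomogeneousIdeal
    (MvPolynomial.homogeneousSubmodule (Fin (n + 1)) k)} (hI : I.toIdeal ≠ ⊤)
    (h : ∀ d : ℕ, 0 < d → ∀ r : MvPolynomial (Fin (n + 1)) k, r.IsHomogeneous d → r ∈ I → r ∈ J) :
    I ≤ J := by
  intro r hr
  rw [← MvPolynomial.sum_homogeneousComponent r]
  refine sum_mem fun d _ => ?_
  have hd : MvPolynomial.homogeneousComponent d r ∈ I := by
    exact MvPolynomial.homogeneousComponent_mem_of_mem I.isHomogeneous hr d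
  obtain rfl | hd0 := Nat.eq_zero_or_pos d
  · rw [MvPolynomial.homogeneousComponent_zero] at hd ⊢
    by_cases h0 : MvPolynomial.coeff 0 r = 0
    · rw [h0, map_zero]
      exact zero_mem _
    · exact absurd (Ideal.eq_top_of_isUnit_mem _ hd ((IsUnit.mk0 _ h0).map MvPolynomial.C)) hI
  · exact h d hd0 _ (MvPolynomial.homogeneousComponent_isHomogeneous d r) hd


/-- The ideal on the right is the vertex of the affine cone. It lies strictly above every point of
Proj and supplies the extra step in chains on the cone. -/
theorem homogeneousIdeal_lt_ker_constantCoeff {n : ℕ} (y : projSpace k n) :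
    y.asHomogeneousIdeal.toIdeal <
      RingHom.ker (MvPolynomial.constantCoeff : MvPolynomial (Fin (n + 1)) k →+* k) := by
  have hle : y.asHomogeneousIdeal.toIdeal ≤
      RingHom.ker (MvPolynomial.constantCoeff : MvPolynomial (Fin (n + 1)) k →+* k) := by
    intro r hr
    have hd := MvPolynomial.homogeneousComponent_mem_of_mem y.asHomogeneousIdeal.isHomogeneous hr 0
    rw [MvPolynomial.homogeneousComponent_zero] at hd
    rw [RingHom.mem_ker, MvPolynomial.constantCoeff_eq]
    by_contra h0
    exact y.isPrime.ne_top
      (Ideal.eq_top_of_isUnit_mem _ hd ((IsUnit.mk0 _ h0).map MvPolynomial.C))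
  refine lt_of_le_not_ge hle fun hge => y.not_irrelevant_le fun r hr => hge ?_
  have h0 : MvPolynomial.homogeneousComponent 0 r = 0 :=
    (MvPolynomial.decomposition.decompose'_apply r 0).symm.trans
      ((HomogeneousIdeal.mem_irrelevant_iff _ r).mp hr)
  rw [MvPolynomial.homogeneousComponent_zero] at h0
  rw [RingHom.mem_ker, MvPolynomial.constantCoeff_eq]
  exact (map_eq_zero_iff _ (MvPolynomial.C_injective _ _)).mp h0

/-- A chain of irreducible closed subsets of the closure gives a chain of homogeneous primes over
the cone ideal, which the vertex prolongs by one. The cone has dimension at most two, so the closure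
has dimension at most one. -/
theorem topologicalKrullDim_closure_le {n : ℕ} {K : Type*} [Field K] [Algebra k K]
    {f : Fin (n + 1) → K} {y₀ : projSpace k n}
    (hy₀ : ∀ d : ℕ, 0 < d → ∀ r : MvPolynomial (Fin (n + 1)) k, r.IsHomogeneous d →
      MvPolynomial.aeval f r = 0 → r ∈ y₀.asHomogeneousIdeal)
    {i₀ i₁ : Fin (n + 1)} (h₀ : f i₀ ≠ 0)
    (halg : ∀ i, IsAlgebraic (Algebra.adjoin k {f i₁ / f i₀}) (f i / f i₀)) :
    topologicalKrullDim (closure ({y₀} : Set (projSpace k n))) ≤ 1 := by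
  set Z := closure ({y₀} : Set (projSpace k n)) with hZ
  let I := RingHom.ker (coneHom k f)
  have hdim : Order.krullDim
      (PrimeSpectrum.zeroLocus (I : Set (MvPolynomial (Fin (n + 1)) k))) ≤ 2 := by
    rw [← ringKrullDim_quotient,
      ringKrullDim_eq_of_ringEquiv (Ideal.quotientKerEquivRange (coneHom k f)).toRingEquiv]
    exact ringKrullDim_coneHom_range_le h₀ halg
  let g : IrreducibleCloseds Z → IrreducibleCloseds (projSpace k n) :=
    IrreducibleCloseds.map Subtype.val continuous_subtype_val
  have hg : StrictMono g := IrreducibleCloseds.map_strictMono_of_isInducing .subtypeVal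
  let p : IrreducibleCloseds Z → projSpace k n := fun C => (g C).isIrreducible.genericPoint
  have hp : ∀ C, closure {p C} = (g C : Set (projSpace k n)) := fun C =>
    (IsIrreducible.genericPoint_closure_eq _).trans (g C).isClosed.closure_eq
  have hlt : ∀ C C', C < C' →
      (p C').asHomogeneousIdeal.toIdeal < (p C).asHomogeneousIdeal.toIdeal := by
    intro C C' hC
    have h := hg hC
    refine lt_of_le_not_ge (projSpace_specializes_iff.mp ?_) fun hge => h.not_ge ?_
    · rw [specializes_iff_closure_subset, hp, hp]
      exact h.le
    · have := specializes_iff_closure_subset.mp (projSpace_specializes_iff.mpr hge)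
      rwa [hp, hp] at this
  have hker : ∀ C, I ≤ (p C).asHomogeneousIdeal.toIdeal := by
    intro C r hr
    have hmem : p C ∈ Z := by
      have h1 : p C ∈ closure {p C} := subset_closure rfl
      rw [hp] at h1
      refine closure_minimal ?_ isClosed_closure h1
      rintro _ ⟨z, -, rfl⟩
      exact z.2
    have hle := projSpace_specializes_iff.mp (specializes_iff_mem_closure.mpr hmem)
    refine hle ?_
    rw [← MvPolynomial.sum_homogeneousComponent r]
    refine sum_mem fun d _ => ?_
    have hd : MvPolynomial.aeval f (MvPolynomial.homogeneousComponent d r) = 0 := by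
      rw [← coeff_coneHom, RingHom.mem_ker.mp hr, Polynomial.coeff_zero]
    obtain rfl | hd0 := Nat.eq_zero_or_pos d
    · rw [MvPolynomial.homogeneousComponent_zero, MvPolynomial.aeval_C,
        map_eq_zero_iff _ (algebraMap k K).injective] at hd
      rw [MvPolynomial.homogeneousComponent_zero, hd, map_zero]
      exact zero_mem _
    · exact hy₀ d hd0 _ (MvPolynomial.homogeneousComponent_isHomogeneous d r) hd
  have hne : Nonempty (IrreducibleCloseds Z) :=
    ⟨closure {⟨y₀, subset_closure rfl⟩}, isIrreducible_singleton.closure, isClosed_closure⟩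
  let M : PrimeSpectrum (MvPolynomial (Fin (n + 1)) k) :=
    ⟨RingHom.ker MvPolynomial.constantCoeff, RingHom.ker_isPrime _⟩
  let Q : IrreducibleCloseds Z → PrimeSpectrum.zeroLocus (I : Set (MvPolynomial (Fin (n + 1)) k)) :=
    fun C => ⟨⟨_, (p C).isPrime⟩, hker C⟩
  let QM : PrimeSpectrum.zeroLocus (I : Set (MvPolynomial (Fin (n + 1)) k)) :=
    ⟨M, (hker hne.some).trans (homogeneousIdeal_lt_ker_constantCoeff _).le⟩
  -- The added bottom element goes to the vertex; the order is reversed because larger closed sets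
  -- have smaller primes.
  let F : WithBot (IrreducibleCloseds Z) →
      (PrimeSpectrum.zeroLocus (I : Set (MvPolynomial (Fin (n + 1)) k)))ᵒᵈ :=
    fun C => C.recBotCoe (OrderDual.toDual QM) fun C => OrderDual.toDual (Q C)
  have hF : StrictMono F := by
    intro C C' hC
    induction C' using WithBot.recBotCoe with
    | bot => exact absurd hC not_lt_bot
    | coe C' =>
      induction C using WithBot.recBotCoe with
      | bot => exact homogeneousIdeal_lt_ker_constantCoeff (p C')
      | coe C => exact hlt C C' (WithBot.coe_lt_coe.mp hC)
  have h1 := Order.krullDim_le_of_strictMono F hF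
  rw [Order.krullDim_withBot, Order.krullDim_orderDual] at h1
  have h2 : Order.krullDim (IrreducibleCloseds Z) + 1 ≤ 1 + 1 := by
    rw [one_add_one_eq_two]
    exact h1.trans hdim
  exact (ENat.WithBot.add_le_add_one_right_iff ).mp h2

theorem one_le_topologicalKrullDim_closure {T : Type*} [TopologicalSpace T] {x y : T}
    (hxy : x ⤳ y) (hyx : ¬ y ⤳ x) : 1 ≤ topologicalKrullDim (closure ({x} : Set T)) := by
  rw [topologicalKrullDim, Order.one_le_krullDim_iff]
  let x' : closure ({x} : Set T) := ⟨x, subset_closure rfl⟩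
  let y' : closure ({x} : Set T) := ⟨y, specializes_iff_mem_closure.mp hxy⟩
  have h1 : x' ⤳ y' := Topology.IsInducing.subtypeVal.specializes_iff.mp hxy
  have h2 : ¬ y' ⤳ x' := fun h => hyx (Topology.IsInducing.subtypeVal.specializes_iff.mpr h)
  refine ⟨⟨closure {y'}, isIrreducible_singleton.closure, isClosed_closure⟩,
    ⟨closure {x'}, isIrreducible_singleton.closure, isClosed_closure⟩, ?_⟩
  refine lt_of_le_not_ge (specializes_iff_closure_subset.mp h1) fun h =>
    h2 (specializes_iff_closure_subset.mpr h)

/-- The generic point of X lies in the domain and specializes to every point of it; continuity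
carries this over to the images. -/
theorem imageClosure_eq_closure_singleton {X Y : Scheme.{u}} [IsIntegral X] [Y.IsSeparated]
    (φ : X ⤏ Y) (x : Spec X.functionField) :
    imageClosure φ = closure {φ.fromFunctionField x} := by
  set P := φ.toPartialMap with hP
  have hφ : φ.fromFunctionField = P.fromFunctionField := by
    rw [← Scheme.RationalMap.fromFunctionField_toRationalMap, hP,
      Scheme.RationalMap.toRationalMap_toPartialMap]
  have hmem : genericPoint X ∈ P.domain :=
    (genericPoint_specializes _).mem_open P.domain.2 P.dense_domain.nonempty.choose_spec
  let η : P.domain.toScheme := P.domain.fromSpecStalkOfMem _ hmem x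
  have hη : P.domain.ι η = genericPoint X := by
    have h1 : P.domain.ι η = X.fromSpecStalk (genericPoint X) x := by
      rw [← Scheme.Opens.fromSpecStalkOfMem_ι P.domain (genericPoint X) hmem]
      rfl
    have h2 : x = IsLocalRing.closedPoint X.functionField := 
      Subsingleton.elim (α := PrimeSpectrum X.functionField) _ _
    rw [h1, h2, Scheme.fromSpecStalk_closedPoint]
  have hξ : φ.fromFunctionField x = P.hom η := by
    rw [hφ]
    rfl
  rw [hξ, imageClosure]
  refine subset_antisymm (closure_minimal ?_ isClosed_closure)
    (closure_mono (Set.singleton_subset_iff.mpr ⟨η, rfl⟩))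
  rintro _ ⟨z, rfl⟩
  have hz : η ⤳ z := by
    refine P.domain.ι.isOpenEmbedding.isInducing.specializes_iff.mp ?_
    rw [hη]
    exact genericPoint_specializes _
  exact specializes_iff_mem_closure.mp (hz.map P.hom.continuous)

theorem exists_imageClosure_rationalMap {X : Scheme.{u}} [IsIntegral X]
    [X.Over (Spec (CommRingCat.of k))] {n : ℕ} (f : Fin (n + 1) → X.functionField) (hf : f ≠ 0) :
    ∃ ξ : projSpace k n, imageClosure (rationalMap k f hf) = closure {ξ} ∧
      ∀ d : ℕ, 0 < d → ∀ r : MvPolynomial (Fin (n + 1)) k, r.IsHomogeneous d →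
        (r ∈ ξ.asHomogeneousIdeal ↔ MvPolynomial.aeval f r = 0) := by
  have hinj : Function.Injective (Scheme.ΓSpecIso X.functionField).inv.hom :=
    (ConcreteCategory.bijective_of_isIso (Scheme.ΓSpecIso X.functionField).inv).1
  let x : Spec X.functionField := IsLocalRing.closedPoint X.functionField
  refine ⟨functionFieldPoint k f hf x, ?_, fun d hd r hr => ?_⟩
  · rw [imageClosure_eq_closure_singleton _ x, rationalMap,
      Scheme.RationalMap.fromFunctionField_ofFunctionField]
  · exact (mem_fromOfGlobalSections_iff k (F := X.functionField) (evalFunctions k f)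
      (evalFunctions_irrelevant k f hf) x hd hr).trans (map_eq_zero_iff _ hinj)

/-- The image of the rational map given by a tuple of rational functions is a curve if all their
quotients are algebraic over one of them and there is a proper specialization of the tuple. -/
theorem topologicalKrullDim_imageClosure_eq_one {X : Scheme.{u}} [IsIntegral X]
    [X.Over (Spec (CommRingCat.of k))] {n : ℕ} {f : Fin (n + 1) → X.functionField} (hf : f ≠ 0)
    {i₀ i₁ : Fin (n + 1)} (h₀ : f i₀ ≠ 0)
    (halg : ∀ i, IsAlgebraic (Algebra.adjoin k {f i₁ / f i₀}) (f i / f i₀))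
    (hconst : f i₁ / f i₀ ∉ Set.range (algebraMap k X.functionField))
    {c : Fin (n + 1) → k} (hc₀ : c i₀ = 1)
    (hc : ∀ r : MvPolynomial (Fin (n + 1)) k,
      MvPolynomial.aeval (fun i => f i / f i₀) r = 0 → MvPolynomial.aeval c r = 0) :
    topologicalKrullDim (imageClosure (rationalMap k f hf)) = 1 := by
  obtain ⟨ξ, hξ, hmem⟩ := exists_imageClosure_rationalMap (k := k) f hf
  obtain ⟨y, hy⟩ := exists_point_of_tuple k c
    (fun h => one_ne_zero (hc₀.symm.trans (congrFun h i₀)))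
  have hscale : ∀ d : ℕ, ∀ r : MvPolynomial (Fin (n + 1)) k, r.IsHomogeneous d →
      MvPolynomial.aeval f r = f i₀ ^ d * MvPolynomial.aeval (fun i => f i / f i₀) r := by
    intro d r hr
    have h1 : coneHom k (fun i => f i / f i₀) r =
        Polynomial.C (MvPolynomial.aeval (fun i => f i / f i₀) r) * Polynomial.X ^ d := by
      ext e
      rw [coeff_coneHom, MvPolynomial.homogeneousComponent_of_mem hr, Polynomial.coeff_C_mul_X_pow]
      split_ifs <;> simp
    have h2 : MvPolynomial.aeval f = ((Polynomial.aeval (f i₀)).restrictScalars k).comp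
        (coneHom k fun i => f i / f i₀) := by
      ext i
      simp [coneHom, h₀]
    rw [h2, AlgHom.comp_apply, h1, AlgHom.restrictScalars_apply, map_mul, Polynomial.aeval_C,
      map_pow, Polynomial.aeval_X, mul_comm]
    rfl
  rw [hξ]
  refine le_antisymm (topologicalKrullDim_closure_le
    (fun d hd r hr h => (hmem d hd r hr).mpr h) h₀ halg) ?_
  -- The lower bound comes from the k-point y = [c]: it lies in the closure of ξ, but is not ξ
  -- itself because the map is nonconstant.
  refine one_le_topologicalKrullDim_closure (y := y) ?_ ?_
  · rw [projSpace_specializes_iff]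
    refine homogeneousIdeal_le_of_forall ξ.isPrime.ne_top fun d hd r hr hrξ => ?_
    rw [hy d hd r hr]
    refine hc r ?_
    have h := (hmem d hd r hr).mp hrξ
    rw [hscale d r hr] at h
    exact (mul_eq_zero.mp h).resolve_left (pow_ne_zero _ h₀)
  · intro h
    rw [projSpace_specializes_iff] at h
    -- This linear form vanishes at y. If it vanished at ξ as well, the ratio of the entries `i₁`
    -- and `i₀` would be the constant `c i₁`.
    let r : MvPolynomial (Fin (n + 1)) k := .X i₁ - .C (c i₁) * .X i₀
    have hr : r.IsHomogeneous 1 := (MvPolynomial.isHomogeneous_X k i₁).sub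
      ((MvPolynomial.isHomogeneous_X k i₀).C_mul (c i₁))
    have h1 : r ∈ y.asHomogeneousIdeal := by
      rw [hy 1 one_pos r hr]
      simp [r, hc₀]
    have h2 := (hmem 1 one_pos r hr).mp (h h1)
    refine hconst ⟨c i₁, ?_⟩
    simp only [r, map_sub, map_mul, MvPolynomial.aeval_X, MvPolynomial.aeval_C] at h2
    rw [eq_div_iff h₀]
    exact (sub_eq_zero.mp h2).symm

end ProjectiveImage


/-! ### General points of integral schemes -/

section GeneralPoint

variable {X : Scheme.{u}}

theorem ForGeneralPoint.mono {P Q : X → Prop} (h : ForGeneralPoint X P)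
    (hPQ : ∀ p, IsClosed ({p} : Set X) → P p → Q p) : ForGeneralPoint X Q := by
  obtain ⟨U, hU, h⟩ := h
  exact ⟨U, hU, fun p hp hc => hPQ p hc (h p hp hc)⟩

theorem ForGeneralPoint.of_forall_mem {P : X → Prop} {U : X.Opens} (hU : (U : Set X).Nonempty)
    (h : ∀ p ∈ U, P p) : ForGeneralPoint X P :=
  ⟨U, hU, fun p hp _ => h p hp⟩

variable [IsIntegral X]

theorem ForGeneralPoint.and {P Q : X → Prop} (hP : ForGeneralPoint X P)
    (hQ : ForGeneralPoint X Q) : ForGeneralPoint X fun p => P p ∧ Q p := by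
  obtain ⟨U, hU, hP⟩ := hP
  obtain ⟨V, hV, hQ⟩ := hQ
  refine ⟨U ⊓ V, ?_, fun p hp hc => ⟨hP p hp.1 hc, hQ p hp.2 hc⟩⟩
  exact nonempty_preirreducible_inter U.isOpen V.isOpen hU hV

theorem ForGeneralPoint.forall_mem {ι : Type*} {P : ι → X → Prop} (s : Finset ι)
    (h : ∀ i ∈ s, ForGeneralPoint X (P i)) : ForGeneralPoint X fun p => ∀ i ∈ s, P i p := by
  classical
  induction s using Finset.induction_on with
  | empty => exact ⟨⊤, ⟨genericPoint X, trivial⟩, by simp⟩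
  | insert a s _ ih =>
    refine ((h a (by simp)).and (ih fun i hi => h i (by simp [hi]))).mono ?_
    rintro p _ ⟨h1, h2⟩ i hi
    rcases Finset.mem_insert.mp hi with rfl | hi
    exacts [h1, h2 i hi]

theorem ForGeneralPoint.forall {ι : Type*} [Finite ι] {P : ι → X → Prop}
    (h : ∀ i, ForGeneralPoint X (P i)) : ForGeneralPoint X fun p => ∀ i, P i p := by
  have := Fintype.ofFinite ι
  exact (ForGeneralPoint.forall_mem Finset.univ fun i _ => h i).mono fun p _ hp i => hp i (by simp)

theorem genericPoint_mem {U : X.Opens} (hU : (U : Set X).Nonempty) : genericPoint X ∈ U :=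
  ((genericPoint_spec X).mem_open_set_iff U.isOpen).mpr (by simpa using hU)

-- Closed points are dense in a Jacobson space, so statements about general closed points are not
-- vacuous.
omit [IsIntegral X] in
theorem ForGeneralPoint.exists_isClosed [JacobsonSpace X] {P : X → Prop}
    (h : ForGeneralPoint X P) : ∃ p, IsClosed ({p} : Set X) ∧ P p := by
  obtain ⟨U, hU, h⟩ := h
  obtain ⟨p, hp, hc⟩ := nonempty_inter_closedPoints hU U.isOpen.isLocallyClosed
  exact ⟨p, hc, h p hp hc⟩

/-- Regularity of a rational function at a point. -/
def IsRegularAt (x : X) (s : X.functionField) : Prop :=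
  s ∈ (algebraMap (X.presheaf.stalk x) X.functionField).range

theorem algebraMap_stalk_injective (x : X) :
    Function.Injective (algebraMap (X.presheaf.stalk x) X.functionField) :=
  IsFractionRing.injective _ _

theorem forGeneralPoint_isUnit {s : X.functionField} (hs : s ≠ 0) :
    ForGeneralPoint X fun p => ∃ b : (X.presheaf.stalk p)ˣ,
      algebraMap (X.presheaf.stalk p) X.functionField b = s := by
  obtain ⟨U, -, g, hU, hg, hu⟩ := exists_isUnit_germ_eq X s hs
  refine .of_forall_mem (U := U) ⟨hU.some.1, hU.some.2⟩ fun p hp => ?_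
  refine ⟨(hu.map (X.presheaf.germ U p hp).hom).unit, ?_⟩
  rw [IsUnit.unit_spec, ← hg]
  exact Scheme.algebraMap_germ_eq_germToFunctionField X hp g

theorem forGeneralPoint_isRegularAt (s : X.functionField) :
    ForGeneralPoint X fun p => IsRegularAt p s := by
  by_cases hs : s = 0
  · exact .of_forall_mem (U := ⊤) ⟨genericPoint X, trivial⟩ fun p _ => hs ▸ zero_mem _
  · exact (forGeneralPoint_isUnit hs).mono fun p _ ⟨b, hb⟩ => ⟨b, hb⟩

/-- A general point lies off the support of div s + D, so there s can serve as a reference section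
and other sections are measured by their ratios to s. -/
theorem CartierDivisor.forGeneralPoint_eqn (D : CartierDivisor X) {s : X.functionField}
    (hs : s ≠ 0) : ForGeneralPoint X fun p => ∃ b : (X.presheaf.stalk p)ˣ,
      algebraMap (X.presheaf.stalk p) X.functionField b = s * D.eqn p := by
  obtain ⟨U, hU, h⟩ := D.isLocal (genericPoint X)
  refine ((ForGeneralPoint.of_forall_mem (U := U) ⟨_, hU⟩ h).and
    (forGeneralPoint_isUnit (mul_ne_zero hs (D.eqn_ne_zero (genericPoint X))))).mono ?_
  rintro p _ ⟨⟨a, ha⟩, b, hb⟩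
  exact ⟨a * b, by rw [Units.val_mul, map_mul, hb, ha]; ring⟩

end GeneralPoint

/-! ### Local rings as k-algebras, residue fields and derivations at general points -/

section StalkAlgebra

variable (k : Type u) [Field k] (X : Scheme.{u}) [X.Over (Spec (CommRingCat.of k))]

/-- The local ring of a `k`-scheme as a `k`-algebra. -/
@[reducible]
def stalkAlgebra (x : X) : Algebra k (X.presheaf.stalk x) :=
  RingHom.toAlgebra
    ((Scheme.ΓSpecIso (CommRingCat.of k)).inv ≫ (X ↘ Spec (CommRingCat.of k)).appTop ≫
      X.presheaf.germ ⊤ x trivial).hom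

attribute [local instance low] stalkAlgebra

instance stalkAlgebra_isScalarTower [IsIntegral X] (x : X) :
    IsScalarTower k (X.presheaf.stalk x) X.functionField := by
  refine IsScalarTower.of_algebraMap_eq fun c => ?_
  have : Nonempty (⊤ : X.Opens) := ⟨⟨x, trivial⟩⟩
  exact (Scheme.algebraMap_germ_eq_germToFunctionField X (U := ⊤) (x := x) trivial _).symm

theorem fromSpecStalk_comp_eq (x : X) :
    X.fromSpecStalk x ≫ (X ↘ Spec (CommRingCat.of k)) =
      Spec.map (CommRingCat.ofHom (algebraMap k (X.presheaf.stalk x))) := by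
  rw [← cancel_mono (Spec (CommRingCat.of k)).toSpecΓ, Category.assoc,
    Scheme.toSpecΓ_naturality, Scheme.fromSpecStalk_toSpecΓ_assoc, ← SpecMap_ΓSpecIso_hom,
    ← Spec.map_comp, ← Spec.map_comp]
  congr 1
  change _ = (Scheme.ΓSpecIso (CommRingCat.of k)).hom ≫
    ((Scheme.ΓSpecIso (CommRingCat.of k)).inv ≫ (X ↘ Spec (CommRingCat.of k)).appTop ≫
    X.presheaf.germ ⊤ x trivial)
  rw [Iso.hom_inv_id_assoc]

variable [LocallyOfFiniteType (X ↘ Spec (CommRingCat.of k))]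

/-- By the Nullstellensatz the residue field at a closed point is k. -/
theorem exists_sub_mem_maximalIdeal [IsAlgClosed k] {x : X} (hx : IsClosed ({x} : Set X))
    (b : X.presheaf.stalk x) :
    ∃ c : k, b - algebraMap k (X.presheaf.stalk x) c ∈
      IsLocalRing.maximalIdeal (X.presheaf.stalk x) := by
  have h : (residueFieldIsoBase (X ↘ Spec (CommRingCat.of k)) x hx).inv =
      CommRingCat.ofHom (algebraMap k (X.presheaf.stalk x)) ≫ X.residue x := by
    apply Spec.map_injective
    rw [SpecMap_residueFieldIsoBase_inv, Spec.map_comp, ← fromSpecStalk_comp_eq]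
    rfl
  refine ⟨(residueFieldIsoBase (X ↘ Spec (CommRingCat.of k)) x hx).hom (X.residue x b), ?_⟩
  rw [← IsLocalRing.residue_eq_zero_iff, map_sub, sub_eq_zero]
  change X.residue x b = (CommRingCat.ofHom (algebraMap k (X.presheaf.stalk x)) ≫ X.residue x)
    ((residueFieldIsoBase (X ↘ Spec (CommRingCat.of k)) x hx).hom (X.residue x b))
  rw [← h]
  exact (ConcreteCategory.congr_hom
    (residueFieldIsoBase (X ↘ Spec (CommRingCat.of k)) x hx).hom_inv_id (X.residue x b)).symm

variable [IsIntegral X]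

/-- An affine coordinate ring is generated by finitely many functions, and δ of each is regular at a
general point. The Leibniz and quotient rules extend this to the whole local ring. -/
theorem forGeneralPoint_derivation (δ : Derivation k X.functionField X.functionField) :
    ForGeneralPoint X fun p => ∀ s, IsRegularAt p s → IsRegularAt p (δ s) := by
  obtain ⟨_, ⟨U, hU, rfl⟩, hηU, -⟩ :=
    X.isBasis_affineOpens.exists_subset_of_mem_open (Set.mem_univ (genericPoint X)) isOpen_univ
  have hU : IsAffineOpen U := hU
  have hne : Nonempty U := ⟨_, hηU⟩
  let φ : k →+* Γ(X, U) := ((Scheme.ΓSpecIso (CommRingCat.of k)).inv ≫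
    (X ↘ Spec (CommRingCat.of k)).appLE ⊤ U le_top).hom
  have hφ : φ.FiniteType := by
    have h1 := LocallyOfFiniteType.finiteType_appLE (X ↘ Spec (CommRingCat.of k))
      (isAffineOpen_top _) hU le_top
    refine RingHom.FiniteType.comp h1 (RingHom.FiniteType.of_surjective _ ?_)
    exact (ConcreteCategory.bijective_of_isIso (Scheme.ΓSpecIso (CommRingCat.of k)).inv).2
  let : Algebra k Γ(X, U) := φ.toAlgebra
  have hφK (c : k) : X.germToFunctionField U (algebraMap k Γ(X, U) c) =
      algebraMap k X.functionField c := by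
    change X.presheaf.germ U (genericPoint X) hηU ((X ↘ Spec (CommRingCat.of k)).appLE ⊤ U le_top
      ((Scheme.ΓSpecIso (CommRingCat.of k)).inv c)) = X.presheaf.germ ⊤ (genericPoint X) trivial
        ((X ↘ Spec (CommRingCat.of k)).appTop ((Scheme.ΓSpecIso (CommRingCat.of k)).inv c))
    exact X.presheaf.germ_res_apply (homOfLE le_top) _ hηU _
  obtain ⟨s, hs⟩ := (RingHom.finiteType_algebraMap.mp hφ).out
  refine ((ForGeneralPoint.of_forall_mem (U := U) ⟨_, hηU⟩ fun p hp => hp).and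
    (ForGeneralPoint.forall_mem (P := fun g p =>
      IsRegularAt p (δ (X.germToFunctionField U g))) s fun g _ =>
      forGeneralPoint_isRegularAt _)).mono ?_
  rintro p _ ⟨hp, hreg⟩ _ ⟨b, rfl⟩
  have hgerm (a : Γ(X, U)) : IsRegularAt p (X.germToFunctionField U a) :=
    ⟨_, Scheme.algebraMap_germ_eq_germToFunctionField X hp a⟩
  have hA (a : Γ(X, U)) : IsRegularAt p (δ (X.germToFunctionField U a)) := by
    have ha : a ∈ Algebra.adjoin k (s : Set Γ(X, U)) := hs ▸ trivial
    induction ha using Algebra.adjoin_induction with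
    | mem g hg => exact hreg g hg
    | algebraMap c => rw [hφK, Derivation.map_algebraMap]; exact zero_mem _
    | add a b _ _ ha hb => rw [map_add, map_add]; exact add_mem ha hb
    | mul a b _ _ ha hb =>
      rw [map_mul, Derivation.leibniz]
      exact add_mem (mul_mem (hgerm _) hb) (mul_mem (hgerm _) ha)
  let : Algebra Γ(X, U) (X.presheaf.stalk p) :=
    TopCat.Presheaf.algebra_section_stalk X.presheaf (⟨p, hp⟩ : U)
  have : IsLocalization.AtPrime (X.presheaf.stalk p) (hU.primeIdealOf ⟨p, hp⟩).asIdeal :=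
    hU.isLocalization_stalk ⟨p, hp⟩
  obtain ⟨⟨a, t⟩, hat⟩ := IsLocalization.surj (hU.primeIdealOf ⟨p, hp⟩).asIdeal.primeCompl b
  obtain ⟨u, hu⟩ := IsLocalization.map_units (X.presheaf.stalk p) t
  have hK (a : Γ(X, U)) : algebraMap (X.presheaf.stalk p) X.functionField
      (algebraMap Γ(X, U) (X.presheaf.stalk p) a) = X.germToFunctionField U a :=
    Scheme.algebraMap_germ_eq_germToFunctionField X hp a
  have h1 := congrArg δ (congrArg (algebraMap (X.presheaf.stalk p) X.functionField) hat)
  rw [map_mul, hK, Derivation.leibniz, hK, smul_eq_mul, smul_eq_mul] at h1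
  have h2 : algebraMap (X.presheaf.stalk p) X.functionField (u⁻¹ : (X.presheaf.stalk p)ˣ) *
      X.germToFunctionField U t = 1 := by
    rw [← hK, ← map_mul, ← hu, Units.inv_mul, map_one]
  have h3 : δ (algebraMap (X.presheaf.stalk p) X.functionField b) =
      algebraMap (X.presheaf.stalk p) X.functionField (u⁻¹ : (X.presheaf.stalk p)ˣ) *
      (δ (X.germToFunctionField U a) - algebraMap (X.presheaf.stalk p) X.functionField b *
        δ (X.germToFunctionField U t)) := by
    rw [← h1, add_sub_cancel_left, ← mul_assoc, h2, one_mul]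
  rw [h3]
  exact mul_mem ⟨_, rfl⟩ (sub_mem (hA a) (mul_mem ⟨_, rfl⟩ (hA t)))

end StalkAlgebra

/-! ### Codimension one points -/

/-- Write t = a/s on an affine neighbourhood of p. By Krull's principal ideal theorem a minimal
prime over (a) inside the prime of p has height one; it is the generic point of a component of t =
0. -/
theorem exists_coheight_eq_one {X : Scheme.{u}} [IsIntegral X] [IsLocallyNoetherian X] {p : X}
    {t : X.presheaf.stalk p} (ht : t ∈ IsLocalRing.maximalIdeal (X.presheaf.stalk p))
    (ht0 : t ≠ 0) :
    ∃ z : X, Order.coheight z = 1 ∧ z ⤳ p ∧ ∃ t' ∈ IsLocalRing.maximalIdeal (X.presheaf.stalk z),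
      algebraMap (X.presheaf.stalk z) X.functionField t' =
        algebraMap (X.presheaf.stalk p) X.functionField t := by
  obtain ⟨_, ⟨U, hU, rfl⟩, hp, -⟩ :=
    X.isBasis_affineOpens.exists_subset_of_mem_open (Set.mem_univ p) isOpen_univ
  have hU : IsAffineOpen U := hU
  have hne : Nonempty U := ⟨_, hp⟩
  have : IsNoetherianRing Γ(X, U) := IsLocallyNoetherian.component_noetherian ⟨U, hU⟩
  let : Algebra Γ(X, U) (X.presheaf.stalk p) :=
    TopCat.Presheaf.algebra_section_stalk X.presheaf (⟨p, hp⟩ : U)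
  let P := hU.primeIdealOf ⟨p, hp⟩
  have : IsLocalization.AtPrime (X.presheaf.stalk p) P.asIdeal := hU.isLocalization_stalk ⟨p, hp⟩
  obtain ⟨⟨a, s⟩, has⟩ := IsLocalization.surj P.asIdeal.primeCompl t
  have hs := IsLocalization.map_units (X.presheaf.stalk p) s
  have ha : a ∈ P.asIdeal := by
    refine (IsLocalization.AtPrime.to_map_mem_maximal_iff (X.presheaf.stalk p) P.asIdeal a).mp ?_
    rw [← has]
    exact Ideal.mul_mem_right _ _ ht
  have ha0 : a ≠ 0 := by
    rintro rfl
    rw [map_zero] at has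
    exact ht0 ((hs.mul_left_eq_zero).mp has)
  obtain ⟨q, hq, hqP⟩ := Ideal.exists_minimalPrimes_le
    ((Ideal.span_singleton_le_iff_mem P.asIdeal).mpr ha)
  have hqp : q.IsPrime := hq.1.1
  have haq : a ∈ q := hq.1.2 (Ideal.mem_span_singleton_self a)
  have hheight : q.height = 1 := by
    refine le_antisymm (Ideal.height_le_one_of_isPrincipal_of_mem_minimalPrimes _ _ hq) ?_
    rw [Order.one_le_iff_ne_zero, Ne, Ideal.height_eq_zero_iff_eq_bot]
    rintro rfl
    exact ha0 haq
  let y : PrimeSpectrum Γ(X, U) := ⟨q, hqp⟩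
  have hz : hU.fromSpec y ∈ U := by
    have : hU.fromSpec y ∈ hU.fromSpec.opensRange := ⟨y, rfl⟩
    rwa [hU.opensRange_fromSpec] at this
  let : Algebra Γ(X, U) (X.presheaf.stalk (hU.fromSpec y)) :=
    TopCat.Presheaf.algebra_section_stalk X.presheaf (⟨hU.fromSpec y, hz⟩ : U)
  have : IsLocalization.AtPrime (X.presheaf.stalk (hU.fromSpec y)) y.asIdeal :=
    hU.isLocalization_stalk' y hz
  refine ⟨hU.fromSpec y, ?_, ?_, ?_⟩
  · have h := IsLocalization.AtPrime.ringKrullDim_eq_height y.asIdeal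
      (X.presheaf.stalk (hU.fromSpec y))
    rw [ringKrullDim_stalk_eq_coheight] at h
    rw [show y.asIdeal.height = 1 from hheight] at h
    exact_mod_cast h
  · have h : y ⤳ P := (PrimeSpectrum.le_iff_specializes y P).mp hqP
    have h' := h.map hU.fromSpec.continuous
    rwa [hU.fromSpec_primeIdealOf ⟨p, hp⟩] at h'
  · have hsy : IsUnit (algebraMap Γ(X, U) (X.presheaf.stalk (hU.fromSpec y)) s) :=
      IsLocalization.map_units (X.presheaf.stalk (hU.fromSpec y))
        (⟨s, fun h => s.2 (hqP h)⟩ : y.asIdeal.primeCompl)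
    obtain ⟨w, hw⟩ := hsy
    refine ⟨algebraMap _ _ a * (w⁻¹ : (X.presheaf.stalk (hU.fromSpec y))ˣ),
      Ideal.mul_mem_right _ _ ?_, ?_⟩
    · exact (IsLocalization.AtPrime.to_map_mem_maximal_iff _ y.asIdeal a).mpr haq
    have h1 (c : Γ(X, U)) : algebraMap (X.presheaf.stalk p) X.functionField
        (algebraMap Γ(X, U) (X.presheaf.stalk p) c) = X.germToFunctionField U c :=
      Scheme.algebraMap_germ_eq_germToFunctionField X hp c
    have h2 (c : Γ(X, U)) : algebraMap (X.presheaf.stalk (hU.fromSpec y)) X.functionField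
        (algebraMap Γ(X, U) (X.presheaf.stalk (hU.fromSpec y)) c) = X.germToFunctionField U c :=
      Scheme.algebraMap_germ_eq_germToFunctionField X hz c
    rw [map_mul, h2, ← h1, ← has, map_mul, h1, ← h2, ← hw, mul_assoc, ← map_mul, Units.mul_inv,
      map_one, mul_one]


/-! ### Conditions imposed by a general double point -/

section DoublePoint

variable (k : Type u) [Field k] {X : Scheme.{u}} [IsIntegral X]
  [X.Over (Spec (CommRingCat.of k))]

theorem sections_add_single (D : CartierDivisor X) {Z : X →₀ ℕ} {p : X} (hp : p ∉ Z.support)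
    (m : ℕ) : sections k D (Z + Finsupp.single p m) = sections k D Z ⊓ D.multGE k p m := by
  have hp0 : Z p = 0 := by simpa using hp
  apply le_antisymm
  · refine le_inf (le_iInf fun x => (iInf_le _ x).trans ?_) ((iInf_le _ p).trans ?_)
    · rintro s ⟨b, hb, hs⟩
      exact ⟨b, Ideal.pow_le_pow_right (by simp) hb, hs⟩
    · simp [hp0]
  · refine le_iInf fun x => ?_
    by_cases hx : x = p
    · subst hx
      simp [hp0]
    · exact inf_le_left.trans ((iInf_le _ x).trans (by simp [Finsupp.single_eq_of_ne hx]))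

theorem virtualDim_add_single (D : CartierDivisor X) {Z : X →₀ ℕ} {p : X} (hp : p ∉ Z.support) :
    virtualDim k D (Z + Finsupp.single p 2) = virtualDim k D Z - 3 := by
  classical
  unfold virtualDim
  rw [Finsupp.sum_add_index_of_disjoint, Finsupp.sum_single_index]
  · norm_num; ring
  · simp
  · exact Disjoint.mono_right Finsupp.support_single_subset (by simpa using hp)

/-- The virtual dimension drops by 3 = 2·3/2. Specialty forces the actual dimension to be
nonnegative and to drop by at most 2. -/
theorem finrank_le_of_isSpecial {D : CartierDivisor X} {Z : X →₀ ℕ} {p : X} (hp : p ∉ Z.support)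
    (hL : ¬ IsSpecial k D Z) (hL2 : IsSpecial k D (Z + Finsupp.single p 2)) :
    0 < Module.finrank k ↥(sections k D (Z + Finsupp.single p 2)) ∧
    Module.finrank k ↥(sections k D Z) ≤
      Module.finrank k ↥(sections k D (Z + Finsupp.single p 2)) + 2 := by
  unfold IsSpecial expectedDim at hL hL2
  rw [virtualDim_add_single k D hp] at hL2
  unfold dimSystem at hL hL2
  omega

theorem finrank_pos_of_isSpecial {D : CartierDivisor X} {Z : X →₀ ℕ} (h : IsSpecial k D Z) :
    0 < Module.finrank k ↥(sections k D Z) := by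
  unfold IsSpecial expectedDim dimSystem at h
  omega

/-- Otherwise the generic point would itself be a general closed point. Its local ring is a field,
so no nonzero section has multiplicity two there, while special systems are nonempty. -/
theorem not_isClosed_genericPoint {D : CartierDivisor X} {Z : X →₀ ℕ}
    (hL2 : ForGeneralPoint X fun p => IsSpecial k D (Z + Finsupp.single p 2)) :
    ¬ IsClosed ({genericPoint X} : Set X) := by
  intro hc
  obtain ⟨U, hU, h⟩ := hL2
  have h := finrank_pos_of_isSpecial k (h _ (genericPoint_mem hU) hc)
  have hbot : sections k D (Z + Finsupp.single (genericPoint X) 2) = ⊥ := by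
    rw [eq_bot_iff]
    refine (iInf_le _ (genericPoint X)).trans ?_
    rintro s ⟨b, hb, hs⟩
    have hm : IsLocalRing.maximalIdeal (X.presheaf.stalk (genericPoint X)) = ⊥ :=
      IsLocalRing.maximalIdeal_eq_bot (R := X.functionField)
    rw [hm, Finsupp.add_apply, Finsupp.single_eq_same, ← Ideal.zero_eq_bot, zero_pow (by omega),
      Ideal.zero_eq_bot, Ideal.mem_bot] at hb
    rw [hb, map_zero, eq_comm, mul_eq_zero] at hs
    exact hs.resolve_right (D.eqn_ne_zero _)
  rw [hbot, finrank_bot] at h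
  exact lt_irrefl _ h

theorem forGeneralPoint_notMem_support (hη : ¬ IsClosed ({genericPoint X} : Set X))
    {Z : X →₀ ℕ} (hZ : ∀ p ∈ Z.support, IsClosed ({p} : Set X)) :
    ForGeneralPoint X fun p => p ∉ Z.support := by
  refine (ForGeneralPoint.forall_mem (P := fun q p => p ≠ q) Z.support fun q hq => ?_).mono
    fun p _ h hp => h p hp rfl
  exact .of_forall_mem (U := ⟨{q}ᶜ, (hZ q hq).isOpen_compl⟩)
    ⟨genericPoint X, fun h => hη (h ▸ hZ q hq)⟩ fun p hp => hp

variable {k} in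
theorem CartierDivisor.mem_multGE_iff {D : CartierDivisor X} {p : X} {f : X.functionField}
    (hf : f ≠ 0) {α : (X.presheaf.stalk p)ˣ}
    (hα : algebraMap (X.presheaf.stalk p) X.functionField α = f * D.eqn p) {m : ℕ}
    {s : X.functionField} : s ∈ D.multGE k p m ↔
      ∃ b ∈ IsLocalRing.maximalIdeal (X.presheaf.stalk p) ^ m,
        algebraMap (X.presheaf.stalk p) X.functionField b = s / f := by
  have hα' : algebraMap (X.presheaf.stalk p) X.functionField (α⁻¹ : (X.presheaf.stalk p)ˣ) *
      (f * D.eqn p) = 1 := by rw [← hα, ← map_mul, Units.inv_mul, map_one]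
  constructor
  · rintro ⟨b, hb, hs⟩
    refine ⟨b * (α⁻¹ : (X.presheaf.stalk p)ˣ), Ideal.mul_mem_right _ _ hb, ?_⟩
    rw [map_mul, hs, eq_div_iff hf]
    linear_combination s * hα'
  · rintro ⟨b, hb, hs⟩
    refine ⟨b * α, Ideal.mul_mem_right _ _ hb, ?_⟩
    rw [map_mul, hs, hα]
    field_simp

attribute [local instance low] stalkAlgebra

/-- The sections modulo those with a double point at p embed in 𝒪/𝔪², which is finite over k. -/
theorem finite_of_finite_inf_multGE [IsAlgClosed k]
    [LocallyOfFiniteType (X ↘ Spec (CommRingCat.of k))] {D : CartierDivisor X} {p : X}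
    (hp : IsClosed ({p} : Set X)) {V : Submodule k X.functionField} (hV : V ≤ D.multGE k p 0)
    [Module.Finite k ↥(V ⊓ D.multGE k p 2)] : Module.Finite k V := by
  have : IsLocallyNoetherian X :=
    LocallyOfFiniteType.isLocallyNoetherian (X ↘ Spec (CommRingCat.of k))
  have hfin : Module.Finite k (X.presheaf.stalk p ⧸
      IsLocalRing.maximalIdeal (X.presheaf.stalk p) ^ 2) :=
    finite_quotient_maximalIdeal_sq (exists_sub_mem_maximalIdeal k X hp)
  let A : X.presheaf.stalk p →ₗ[k] X.functionField :=
    (IsScalarTower.toAlgHom k (X.presheaf.stalk p) X.functionField).toLinearMap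
  have hA : Function.Injective A := algebraMap_stalk_injective p
  let ψ : V →ₗ[k] LinearMap.range A :=
    ((LinearMap.mulRight k (D.eqn p)).comp V.subtype).codRestrict _ fun s => by
      obtain ⟨b, -, hb⟩ := hV s.2
      exact ⟨b, hb⟩
  let φ : V →ₗ[k] X.presheaf.stalk p ⧸ IsLocalRing.maximalIdeal (X.presheaf.stalk p) ^ 2 :=
    (Ideal.Quotient.mkₐ k _).toLinearMap ∘ₗ (LinearEquiv.ofInjective A hA).symm.toLinearMap ∘ₗ ψ
  have hφ (s : V) (hs : s ∈ LinearMap.ker φ) : (s : X.functionField) ∈ V ⊓ D.multGE k p 2 := by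
    refine ⟨s.2, (LinearEquiv.ofInjective A hA).symm (ψ s), Ideal.Quotient.eq_zero_iff_mem.mp hs,
        ?_⟩
    exact congrArg Subtype.val ((LinearEquiv.ofInjective A hA).apply_symm_apply (ψ s))
  have h1 : Module.Finite k (LinearMap.ker φ) := by
    refine Module.Finite.of_injective (M := LinearMap.ker φ) (N := ↥(V ⊓ D.multGE k p 2))
      ((V.subtype.comp (LinearMap.ker φ).subtype).codRestrict _ fun s => hφ _ s.2) ?_
    intro s t h
    have h' : ((s : V) : X.functionField) = (t : V) := 
      congrArg (fun z : ↥(V ⊓ D.multGE k p 2) => (z : X.functionField)) h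
    exact Subtype.ext (Subtype.ext h')
  have h2 : Module.Finite k (V ⧸ LinearMap.ker φ) :=
    Module.Finite.equiv φ.quotKerEquivRange.symm
  exact Module.Finite.of_submodule_quotient (LinearMap.ker φ)

end DoublePoint

/-! ### Systems with a special general double point -/

section Main

attribute [local instance low] stalkAlgebra

theorem IsRegularAt.of_specializes {X : Scheme.{u}} [IsIntegral X] {z p : X} (h : z ⤳ p)
    {s : X.functionField} (hs : IsRegularAt p s) : IsRegularAt z s := by
  obtain ⟨b, rfl⟩ := hs
  refine ⟨X.presheaf.stalkSpecializes h b, ?_⟩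
  exact ConcreteCategory.congr_hom (X.presheaf.stalkSpecializes_comp
    ((genericPoint_spec X).specializes trivial) h) b

theorem algebraicIndependent_pair {k K : Type*} [Field k] [Field K] [Algebra k K] {x y : K}
    (hx : Transcendental k x) (hy : Transcendental (Algebra.adjoin k {x}) y) :
    AlgebraicIndependent k fun o : Option Unit => o.elim y fun _ => x := by
  rw [AlgebraicIndependent.option_iff_transcendental, Set.range_const]
  · exact hy
  · exact algebraicIndependent_unique_type_iff.mpr hx

theorem mem_range_algebraMap_of_isAlgebraic {k K : Type*} [Field k] [IsAlgClosed k] [Field K]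
    [Algebra k K] {x : K} (hx : IsAlgebraic k x) : x ∈ Set.range (algebraMap k K) :=
  minpoly.mem_range_of_degree_eq_one k x
    (IsAlgClosed.degree_eq_one_of_irreducible k (minpoly.irreducible hx.isIntegral))

variable {k : Type u} [Field k] {X : Scheme.{u}} [IsIntegral X] [X.Over (Spec (CommRingCat.of k))]
  [LocallyOfFiniteType (X ↘ Spec (CommRingCat.of k))] {D : CartierDivisor X}
  {V : Submodule k X.functionField} [Module.Finite k V]

/-- Otherwise f₀, f₁, f₂ would span a three-dimensional space meeting the sections singular at p
only in 0, against the bound of two conditions. -/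
theorem isAlgebraic_adjoin_of_finrank_le [CharZero k] [JacobsonSpace X]
    (hV : ForGeneralPoint X fun p =>
      Module.finrank k V ≤ Module.finrank k ↥(V ⊓ D.multGE k p 2) + 2)
    {f₀ f₁ f₂ : X.functionField} (h₀ : f₀ ∈ V) (h₁ : f₁ ∈ V) (h₂ : f₂ ∈ V) (hf : f₀ ≠ 0)
    (hx : Transcendental k (f₁ / f₀)) :
    IsAlgebraic (Algebra.adjoin k {f₁ / f₀}) (f₂ / f₀) := by
  by_contra hy
  have hind := algebraicIndependent_pair hx hy
  obtain ⟨δ₁, hδ₁⟩ := exists_derivation_of_algebraicIndependent hind (some ())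
  obtain ⟨δ₂, hδ₂⟩ := exists_derivation_of_algebraicIndependent hind none
  have h11 : δ₁ (f₁ / f₀) = 1 := by simpa using hδ₁ (some ())
  have h12 : δ₁ (f₂ / f₀) = 0 := by simpa using hδ₁ none
  have h21 : δ₂ (f₁ / f₀) = 0 := by simpa using hδ₂ (some ())
  have h22 : δ₂ (f₂ / f₀) = 1 := by simpa using hδ₂ none
  obtain ⟨p, -, ⟨⟨hrank, α, hα⟩, hr₁⟩, hr₂⟩ := (((hV.and (D.forGeneralPoint_eqn hf)).and
    (forGeneralPoint_derivation k X δ₁)).and (forGeneralPoint_derivation k X δ₂)).exists_isClosed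
  have hr₁' (b : X.presheaf.stalk p) : ∃ c : X.presheaf.stalk p,
      δ₁ (algebraMap _ X.functionField b) = algebraMap _ X.functionField c := by
    obtain ⟨c, hc⟩ := hr₁ _ ⟨b, rfl⟩
    exact ⟨c, hc.symm⟩
  have hr₂' (b : X.presheaf.stalk p) : ∃ c : X.presheaf.stalk p,
      δ₂ (algebraMap _ X.functionField b) = algebraMap _ X.functionField c := by
    obtain ⟨c, hc⟩ := hr₂ _ ⟨b, rfl⟩
    exact ⟨c, hc.symm⟩
  have hconst (a : k) {c : X.presheaf.stalk p} (hc : c ∈ IsLocalRing.maximalIdeal _)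
      (h : algebraMap k X.functionField a = algebraMap _ X.functionField c) : a = 0 := by
    rw [IsScalarTower.algebraMap_apply k (X.presheaf.stalk p)] at h
    rw [← algebraMap_stalk_injective p h] at hc
    exact eq_zero_of_algebraMap_mem_maximalIdeal hc
  let T : (Fin 3 → k) →ₗ[k] X.functionField := Fintype.linearCombination k ![f₀, f₁, f₂]
  have hTapp (c : Fin 3 → k) : T c = c 0 • f₀ + c 1 • f₁ + c 2 • f₂ := by
    simp [T, Fintype.linearCombination_apply, Fin.sum_univ_three]
  -- If c₀ + c₁x + c₂y lies in 𝔪² for the two ratios x, y, the dual derivations send it to c₁ and c₂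
  -- in 𝔪. Both therefore vanish, and then so does c₀.
  have hT (c : Fin 3 → k) (hc : T c ∈ D.multGE k p 2) : c = 0 := by
    obtain ⟨b, hb, hbc⟩ := (CartierDivisor.mem_multGE_iff hf hα).mp hc
    have hb' : algebraMap _ X.functionField b = algebraMap k X.functionField (c 0) +
        c 1 • (f₁ / f₀) + c 2 • (f₂ / f₀) := by
      rw [hbc, hTapp, Algebra.smul_def, Algebra.smul_def, Algebra.smul_def, Algebra.smul_def,
        Algebra.smul_def]
      field_simp
    obtain ⟨b₁, hb₁, e₁⟩ := derivation_mem_maximalIdeal hr₁' hb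
    obtain ⟨b₂, hb₂, e₂⟩ := derivation_mem_maximalIdeal hr₂' hb
    rw [hb', map_add, map_add, Derivation.map_algebraMap, Derivation.map_smul,
        Derivation.map_smul, h11, h12, zero_add,
      smul_zero, add_zero, ← Algebra.algebraMap_eq_smul_one] at e₁
    rw [hb', map_add, map_add, Derivation.map_algebraMap, Derivation.map_smul,
        Derivation.map_smul, h21, h22, zero_add,
      smul_zero, zero_add, ← Algebra.algebraMap_eq_smul_one] at e₂
    have c1 := hconst _ hb₁ e₁
    have c2 := hconst _ hb₂ e₂
    rw [c1, c2, zero_smul, zero_smul, add_zero, add_zero] at hb'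
    have c0 := hconst _ (Ideal.pow_le_self two_ne_zero hb) hb'.symm
    ext i
    fin_cases i
    exacts [c0, c1, c2]
  have hinj : Function.Injective T :=
    (injective_iff_map_eq_zero T).mpr fun c hc => hT c (hc ▸ zero_mem _)
  have hle : LinearMap.range T ≤ V := by
    rintro _ ⟨c, rfl⟩
    rw [hTapp]
    exact add_mem (add_mem (V.smul_mem _ h₀) (V.smul_mem _ h₁)) (V.smul_mem _ h₂)
  have hinf : LinearMap.range T ⊓ (V ⊓ D.multGE k p 2) = ⊥ := by
    rw [eq_bot_iff]
    rintro _ ⟨⟨c, rfl⟩, hc⟩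
    rw [hT c hc.2, map_zero]
    exact zero_mem _
  have hWfin : Module.Finite k ↥(V ⊓ D.multGE k p 2) :=
    Module.Finite.of_injective (Submodule.inclusion inf_le_left) (Submodule.inclusion_injective _)
  have h1 := Submodule.finrank_sup_add_finrank_inf_eq (LinearMap.range T) (V ⊓ D.multGE k p 2)
  have h2 : Module.finrank k ↥(LinearMap.range T ⊔ V ⊓ D.multGE k p 2) ≤ Module.finrank k V :=
    Submodule.finrank_mono (sup_le hle inf_le_left)
  rw [hinf, finrank_bot, LinearMap.finrank_range_of_inj hinj, Module.finrank_fin_fun] at h1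
  omega

-- At a general p the section f₀ does not vanish, so a nonzero constant multiple of it cannot have a
-- double point there.
omit [LocallyOfFiniteType (X ↘ Spec (CommRingCat.of k))] [Module.Finite k V] in
theorem exists_notMem_range_algebraMap [JacobsonSpace X]
    (hV : ForGeneralPoint X fun p => V ⊓ D.multGE k p 2 ≠ ⊥) {f₀ : X.functionField}
    (hf : f₀ ≠ 0) : ∃ f₁ ∈ V, f₁ / f₀ ∉ Set.range (algebraMap k X.functionField) := by
  by_contra! h
  obtain ⟨p, -, hW, α, hα⟩ := (hV.and (D.forGeneralPoint_eqn hf)).exists_isClosed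
  obtain ⟨s, ⟨hsV, hs⟩, hs0⟩ := Submodule.exists_mem_ne_zero_of_ne_bot hW
  obtain ⟨b, hb, hbs⟩ := (CartierDivisor.mem_multGE_iff hf hα).mp hs
  obtain ⟨c, hc⟩ := h s hsV
  rw [← hc, IsScalarTower.algebraMap_apply k (X.presheaf.stalk p)] at hbs
  rw [algebraMap_stalk_injective p hbs] at hb
  rw [eq_zero_of_algebraMap_mem_maximalIdeal (Ideal.pow_le_self two_ne_zero hb), map_zero] at hc
  exact div_ne_zero hs0 hf hc.symm

omit [LocallyOfFiniteType (X ↘ Spec (CommRingCat.of k))] in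
theorem algebraMap_eval₂_aeval {p : X} (P : Polynomial (Polynomial k)) (ξ γ : X.presheaf.stalk p) :
    algebraMap (X.presheaf.stalk p) X.functionField
      (P.eval₂ (Polynomial.aeval ξ : Polynomial k →ₐ[k] X.presheaf.stalk p).toRingHom γ) =
    P.eval₂ (Polynomial.aeval (algebraMap (X.presheaf.stalk p) X.functionField ξ) :
      Polynomial k →ₐ[k] X.functionField).toRingHom
      (algebraMap (X.presheaf.stalk p) X.functionField γ) := by
  rw [Polynomial.hom_eval₂]
  congr 1
  refine RingHom.ext fun q => ?_
  exact (Polynomial.aeval_algebraMap_apply X.functionField ξ q).symm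

theorem forGeneralPoint_mem_firstOrder [CharZero k] [IsAlgClosed k] {x : X.functionField}
    (hx : Transcendental k x) {ι : Type*} [Finite ι] {g : ι → X.functionField}
    (hg : ∀ i, IsAlgebraic (Algebra.adjoin k {x}) (g i)) :
    ForGeneralPoint X fun p => ∃ t ∈ IsLocalRing.maximalIdeal (X.presheaf.stalk p),
      t ∉ IsLocalRing.maximalIdeal (X.presheaf.stalk p) ^ 2 ∧
      ∀ i, ∃ γ ∈ firstOrder k t, algebraMap (X.presheaf.stalk p) X.functionField γ = g i := by
  choose P hP hP' using fun i => exists_bivariate_of_isAlgebraic hx (hg i)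
  obtain ⟨δ, hδ⟩ := exists_derivation_of_algebraicIndependent (k := k) (y := fun _ : Unit => x)
    (algebraicIndependent_unique_type_iff.mpr hx) ()
  have hδx : δ x = 1 := by simpa using hδ ()
  refine ((((forGeneralPoint_isRegularAt x).and (.forall fun i =>
    forGeneralPoint_isRegularAt (g i))).and (.forall fun i =>
    forGeneralPoint_isUnit (hP' i))).and (forGeneralPoint_derivation k X δ)).mono ?_
  rintro p hp ⟨⟨⟨⟨ξ, rfl⟩, hreg⟩, hunit⟩, hr⟩
  choose γ hγ using hreg
  choose w hw using hunit
  obtain ⟨a, ha⟩ := exists_sub_mem_maximalIdeal k X hp ξ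
  refine ⟨_, ha, fun h => ?_, fun i => ⟨γ i, ?_, hγ i⟩⟩
  -- Here t = x - a, so δt = 1; if t were in 𝔪², its derivative 1 would lie in 𝔪.
  · obtain ⟨c, hc, e⟩ := derivation_mem_maximalIdeal (δ := δ) (fun b => by
      obtain ⟨c, hc⟩ := hr _ ⟨b, rfl⟩
      exact ⟨c, hc.symm⟩) h
    rw [map_sub, map_sub, ← IsScalarTower.algebraMap_apply, Derivation.map_algebraMap, sub_zero,
      hδx, ← map_one (algebraMap (X.presheaf.stalk p) X.functionField)] at e
    rw [← algebraMap_stalk_injective p e] at hc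
    exact (Ideal.ne_top_iff_one _).mp (IsLocalRing.maximalIdeal.isMaximal _).ne_top hc
  · refine eval₂_aeval_root_mem_firstOrder (P := P i) (exists_sub_mem_maximalIdeal k X hp) ha ?_ ?_
    · apply algebraMap_stalk_injective p
      rw [algebraMap_eval₂_aeval, hγ, map_zero]
      exact hP i
    · have h : ((w i : (X.presheaf.stalk p)ˣ) : X.presheaf.stalk p) =
          (P i).derivative.eval₂ (Polynomial.aeval ξ :
            Polynomial k →ₐ[k] X.presheaf.stalk p).toRingHom (γ i) := by
        apply algebraMap_stalk_injective p
        rw [algebraMap_eval₂_aeval, hγ]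
        exact hw i
      exact h ▸ (w i).isUnit

theorem forGeneralPoint_exists_double_curve [CharZero k] [IsAlgClosed k] {f₀ x : X.functionField}
    (hf : f₀ ≠ 0) (hx : Transcendental k x)
    (hV : ∀ f ∈ V, IsAlgebraic (Algebra.adjoin k {x}) (f / f₀)) :
    ForGeneralPoint X fun p => ∃ z : X, Order.coheight z = 1 ∧ z ⤳ p ∧
      V ⊓ D.multGE k p 2 ≤ D.multGE k z 2 := by
  have : IsLocallyNoetherian X :=
    LocallyOfFiniteType.isLocallyNoetherian (X ↘ Spec (CommRingCat.of k))
  let b := Module.finBasis k V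
  refine ((forGeneralPoint_mem_firstOrder hx (fun i => hV _ (b i).2)).and
    (D.forGeneralPoint_eqn hf)).mono ?_
  rintro p hp ⟨⟨t, ht, ht2, hγ⟩, α, hα⟩
  obtain ⟨z, hz, hzp, t', ht', htt'⟩ := exists_coheight_eq_one ht (fun h => ht2 (h ▸ zero_mem _))
  refine ⟨z, hz, hzp, ?_⟩
  -- The open set was chosen for a finite basis only; linearity covers all of V at once.
  have hV' (s : V) : ∃ γ ∈ firstOrder k t,
      algebraMap (X.presheaf.stalk p) X.functionField γ = s / f₀ := by
    choose γ hγ1 hγ2 using hγ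
    refine ⟨∑ i, b.repr s i • γ i, sum_mem fun i _ => Subalgebra.smul_mem _ (hγ1 i) _, ?_⟩
    conv_rhs => rw [← b.sum_repr s]
    rw [map_sum, AddSubmonoidClass.coe_finsetSum, Finset.sum_div]
    refine Finset.sum_congr rfl fun i _ => ?_
    rw [Submodule.coe_smul, Algebra.smul_def, Algebra.smul_def, map_mul, hγ2, mul_div_assoc,
      ← IsScalarTower.algebraMap_apply]
  rintro s ⟨hsV, hs⟩
  obtain ⟨u, hu2, hu⟩ := (CartierDivisor.mem_multGE_iff hf hα).mp hs
  obtain ⟨γ, hγ1, hγ2⟩ := hV' ⟨s, hsV⟩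
  rw [algebraMap_stalk_injective p (hγ2.trans hu.symm)] at hγ1
  obtain ⟨v, hv⟩ := exists_eq_sq_mul_of_mem_firstOrder ht ht2 hγ1 hu2
  -- Carry s · eqn(p) = t²vα from p to the generic point z of the curve: the local equations differ
  -- by a unit a, and vα remains regular at z.
  obtain ⟨U, hpU, hU⟩ := D.isLocal p
  obtain ⟨a, ha⟩ := hU z (hzp.mem_open U.isOpen hpU)
  obtain ⟨w, hw⟩ := IsRegularAt.of_specializes hzp
    (s := algebraMap (X.presheaf.stalk p) X.functionField (v * α)) ⟨_, rfl⟩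
  refine ⟨t' ^ 2 * (w * a), Ideal.mul_mem_right _ _ (Ideal.pow_mem_pow ht' 2), ?_⟩
  have hs' : s = algebraMap (X.presheaf.stalk p) X.functionField u * f₀ := by
    rw [hu, div_mul_cancel₀ _ hf]
  rw [map_mul, map_pow, htt', map_mul, hw, ha, hs', hv, map_mul, map_mul, map_pow, hα]
  ring

theorem exists_topologicalKrullDim_imageClosure_eq_one [CharZero k] [IsAlgClosed k]
    [JacobsonSpace X]
    {n : ℕ} {f : Fin (n + 1) → X.functionField} (hf : f ≠ 0) {i₀ i₁ : Fin (n + 1)} (h₀ : f i₀ ≠ 0)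
    (halg : ∀ i, IsAlgebraic (Algebra.adjoin k {f i₁ / f i₀}) (f i / f i₀))
    (hconst : f i₁ / f i₀ ∉ Set.range (algebraMap k X.functionField)) :
    topologicalKrullDim (imageClosure (rationalMap k f hf)) = 1 := by
  -- The required specialization is the value of all ratios at one closed point; every polynomial
  -- relation survives reduction modulo its maximal ideal.
  obtain ⟨p, hp, hreg⟩ := (ForGeneralPoint.forall fun i =>
    forGeneralPoint_isRegularAt (f i / f i₀)).exists_isClosed
  choose γ hγ using hreg
  choose c hc using fun i => exists_sub_mem_maximalIdeal k X hp (γ i)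
  refine topologicalKrullDim_imageClosure_eq_one hf h₀ halg hconst (c := c) ?_ fun r hr => ?_
  · have h1 : γ i₀ = 1 := algebraMap_stalk_injective p (by rw [hγ, div_self h₀, map_one])
    have h := hc i₀
    rw [h1, ← map_one (algebraMap k (X.presheaf.stalk p)), ← map_sub] at h
    exact (sub_eq_zero.mp (eq_zero_of_algebraMap_mem_maximalIdeal h)).symm
  · have h1 : MvPolynomial.aeval γ r = 0 := by
      apply algebraMap_stalk_injective p
      rw [← MvPolynomial.aeval_algebraMap_apply, map_zero, ← hr]
      simp only [Function.comp_def, hγ]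
    refine eq_zero_of_algebraMap_mem_maximalIdeal (R := X.presheaf.stalk p) ?_
    have h2 : (Ideal.Quotient.mkₐ k (IsLocalRing.maximalIdeal (X.presheaf.stalk p)))
        (MvPolynomial.aeval γ r) = (Ideal.Quotient.mkₐ k _)
        (MvPolynomial.aeval (fun i => algebraMap k (X.presheaf.stalk p) (c i)) r) := by
      rw [MvPolynomial.comp_aeval_apply, MvPolynomial.comp_aeval_apply]
      congr 2
      funext i
      exact Ideal.Quotient.eq.mpr (hc i)
    rw [h1, map_zero] at h2
    rw [← MvPolynomial.aeval_algebraMap_apply]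
    exact Ideal.Quotient.eq_zero_iff_mem.mp h2.symm

theorem hasDoubleFixedComponentThrough_and_mapHasCurveAsImage [CharZero k] [IsAlgClosed k]
    {Z : X →₀ ℕ}
    (hZ : ∀ p ∈ Z.support, IsClosed ({p} : Set X)) (hL : ¬ IsSpecial k D Z)
    (hL2 : ForGeneralPoint X fun p => IsSpecial k D (Z + Finsupp.single p 2)) :
    (ForGeneralPoint X fun p =>
      HasDoubleFixedComponentThrough k D (Z + Finsupp.single p 2) p) ∧
    MapHasCurveAsImage k D Z := by
  have : JacobsonSpace X := LocallyOfFiniteType.jacobsonSpace (X ↘ Spec (CommRingCat.of k))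
  have hsupp := forGeneralPoint_notMem_support (not_isClosed_genericPoint k hL2) hZ
  have hgen : ForGeneralPoint X fun p =>
      0 < Module.finrank k ↥(sections k D Z ⊓ D.multGE k p 2) ∧
      Module.finrank k ↥(sections k D Z) ≤
        Module.finrank k ↥(sections k D Z ⊓ D.multGE k p 2) + 2 :=
    (hL2.and hsupp).mono fun p _ h => by
      have := finrank_le_of_isSpecial k h.2 hL h.1
      rwa [sections_add_single k D h.2] at this
  have hne : ForGeneralPoint X fun p => sections k D Z ⊓ D.multGE k p 2 ≠ ⊥ :=
    hgen.mono fun p _ h h' => by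
      rw [h', finrank_bot] at h
      exact lt_irrefl _ h.1
  -- `Module.finrank` is 0 for infinite-dimensional spaces, so positivity at one such p gives
  -- finiteness there, and then for all sections.
  obtain ⟨p, hp, ⟨hpos, -⟩, hpZ⟩ := (hgen.and hsupp).exists_isClosed
  have : Module.Finite k ↥(sections k D Z ⊓ D.multGE k p 2) := Module.finite_of_finrank_pos hpos
  have : Module.Finite k (sections k D Z) := finite_of_finite_inf_multGE k hp
    ((iInf_le _ p).trans (by rw [Finsupp.notMem_support_iff.mp hpZ]))
  obtain ⟨n, hn⟩ : ∃ n, Module.finrank k (sections k D Z) = n + 1 :=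
    Nat.exists_eq_add_one.mpr (hpos.trans_le (Submodule.finrank_mono inf_le_left))
  let b := Module.finBasisOfFinrankEq k (sections k D Z) hn
  have h₀ : (b 0 : X.functionField) ≠ 0 := fun h => b.ne_zero 0 (Subtype.ext h)
  obtain ⟨i₁, hi₁⟩ : ∃ i, (b i : X.functionField) / b 0 ∉
      Set.range (algebraMap k X.functionField) := by
    -- If all basis ratios were constant, so would be the ratio of every section to `b 0`.
    by_contra! h
    obtain ⟨f, hf, hf'⟩ := exists_notMem_range_algebraMap hne h₀
    refine hf' (Algebra.mem_bot.mp ?_)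
    have hsum := congrArg Subtype.val (b.sum_repr ⟨f, hf⟩)
    rw [AddSubmonoidClass.coe_finsetSum] at hsum
    rw [← show _ = f from hsum, Finset.sum_div]
    refine sum_mem fun i _ => ?_
    rw [Submodule.coe_smul, smul_div_assoc]
    exact Subalgebra.smul_mem _ (Algebra.mem_bot.mpr (h i)) _
  have hx : Transcendental k ((b i₁ : X.functionField) / b 0) := fun h =>
    hi₁ (mem_range_algebraMap_of_isAlgebraic h)
  have halg (f : X.functionField) (hf : f ∈ sections k D Z) :=
    isAlgebraic_adjoin_of_finrank_le (hgen.mono fun p _ h => h.2) (b 0).2 (b i₁).2 hf h₀ hx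
  refine ⟨?_, n, b, exists_topologicalKrullDim_imageClosure_eq_one (basis_ne_zero k b) h₀
    (fun i => halg _ (b i).2) hi₁⟩
  refine ((hne.and hsupp).and (forGeneralPoint_exists_double_curve (D := D) h₀ hx halg)).mono ?_
  rintro q _ ⟨⟨hq, hqZ⟩, hz⟩
  unfold HasDoubleFixedComponentThrough
  rw [sections_add_single k D hqZ]
  exact ⟨hq, hz⟩

end Main
end FatPointSystems

end

theorem mainTheorem4 (k : Type u) [Field k] [IsAlgClosed k] [CharZero k]
    (X : Scheme.{u}) [X.Over (Spec (CommRingCat.of k))] [IsIntegral X]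
    [SmoothOfRelativeDimension 2 (X ↘ Spec (CommRingCat.of k))]
    (hX : FatPointSystems.IsProjective k X)
    (D : FatPointSystems.CartierDivisor X)
    (Z : X →₀ ℕ) (hZ : ∀ p ∈ Z.support, IsClosed ({p} : Set X))
    (hL : ¬ FatPointSystems.IsSpecial k D Z)
    (hL2 : FatPointSystems.ForGeneralPoint X fun p =>
      FatPointSystems.IsSpecial k D (Z + Finsupp.single p 2)) :
    (FatPointSystems.ForGeneralPoint X fun p =>
      FatPointSystems.HasDoubleFixedComponentThrough k D (Z + Finsupp.single p 2) p) ∧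
    FatPointSystems.MapHasCurveAsImage k D Z := by
  have := SmoothOfRelativeDimension.smooth 2 (X ↘ Spec (CommRingCat.of k))
  exact FatPointSystems.hasDoubleFixedComponentThrough_and_mapHasCurveAsImage hZ hL hL2
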